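/- A \emph{Moebius--Kantor complex} is a 2-complex $\Delta$ with triangle faces all of whose vertex links are isomorphic to the Moebius--Kantor graph (the unique cubic symmetric graph with 16 vertices); it carries the length metric in which every face is a Euclidean equilateral triangle of side 1, and the links carry the angular metric, in which every edge has length $\pi/3$. A \emph{root} at a vertex $x$ is an isometric embedding $\alpha\colon[0,\pi]\hookrightarrow L_x$ into the link at $x$ such that $\alpha(0)$ is a vertex of $L_x$; its \emph{rank} is $\mathrm{rk}(\alpha)=1+N(\alpha)/q_\alpha$, where $N(\alpha)$ is the number of roots $\beta\neq\alpha$ at $x$ with $\beta(0)=\alpha(0)$, $\beta(\pi)=\alpha(\pi)$, and $q_\alpha$ is the valency of $\alpha(0)$ minus 1. A \emph{large triangle} containing a face $f$ is obtained by attaching to $f$, along each of its three sides, a further face of $\Delta$ adjacent to that side; it determines a root $\alpha_x$ at each of the three vertices $x$ of $f$. The \emph{parity} of $f$ is the parity of the number of vertices $x$ of $f$ for which $\alpha_x$ has rank 2 (this does not depend on the large triangle). A \emph{flat} in $\Delta$ is the image of an isometric embedding of the Euclidean plane $\mathbb{R}^2\to\Delta$. An \emph{abstract parity distribution} on $\mathbb{R}^2$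 is an arbitrary map $p$ from the set of faces of the tessellation of $\mathbb{R}^2$ by equilateral triangles of side 1 to $\{0,1\}=\{\text{even},\text{odd}\}$. It is \emph{realized} in $\Delta$ if it is the parity distribution of some flat of $\Delta$, i.e. if there is an isometric embedding $\varphi\colon\mathbb{R}^2\to\Delta$ which maps every face $T$ of the tessellation onto a face of $\Delta$ whose parity is $p(T)$. \textbf{Corollary.} There exists an abstract parity distribution on $\mathbb{R}^2$ which is not realized in any Moebius--Kantor complex. -/

import Mathlib

universe u

/-- A 2-complex with triangle faces. `D` is the set of oriented edges, `rev` reverses the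
orientation, `src` is the initial vertex. The boundary of a face `f` (read from an arbitrary base
corner in an arbitrary sense) is the closed edge path `bd f 0, bd f 1, bd f 2`; the `i`-th side
goes from the corner `i` to the corner `i + 1`. Sides of a face may be identified with each other
and with sides of other faces in an arbitrary way. -/
structure TriangleComplex where
  V : Type u
  D : Type u
  F : Type u
  src : D → V
  rev : D → D
  rev_rev : ∀ d, rev (rev d) = d
  rev_ne : ∀ d, rev d ≠ d
  bd : F → Fin 3 → D
  bd_closed : ∀ f i, src (rev (bd f i)) = src (bd f (i + 1))

/-- The Moebius–Kantor graph, as the generalized Petersen graph `G(8,3)`: an outer octagon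
`(i, false)`, an inner star polygon `(i, true)`, and spokes. -/
def moebiusKantorGraph : SimpleGraph (ZMod 8 × Bool) :=
  SimpleGraph.fromRel fun v w =>
    (v.2 = false ∧ w.2 = false ∧ w.1 = v.1 + 1) ∨
    (v.2 = true ∧ w.2 = true ∧ w.1 = v.1 + 3) ∨
    (v.2 = false ∧ w.2 = true ∧ w.1 = v.1)

/-! ### Roots of a link -/

/-- A root of a link `G`, all of whose edges have angular length `π / 3`: an isometric embedding
of `[0, π]` starting at a link vertex, recorded by its values at `0, π/3, 2π/3, π`. -/
def IsRoot {W : Type u} (G : SimpleGraph W) (α : Fin 4 → W) : Prop :=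
  ∀ i j : Fin 4, (G.dist (α i) (α j) : ℤ) = |((i : ℕ) : ℤ) - ((j : ℕ) : ℤ)|

/-- The rank `1 + N(α) / q_α` of a root, where `N(α)` is the number of roots distinct from `α`
with the same endpoints and `q_α` is the order of `α 0` minus 1. -/
noncomputable def rootRank {W : Type u} (G : SimpleGraph W) (α : Fin 4 → W) : ℚ :=
  1 + ({β : Fin 4 → W | IsRoot G β ∧ α ≠ β ∧ α 0 = β 0 ∧ α 3 = β 3}.ncard : ℚ) /
    (((G.neighborSet (α 0)).ncard : ℚ) - 1)

/-! ### The tessellation of the Euclidean plane by equilateral triangles -/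

/-- The vertex `m + n ω` of the tessellation, `ω = (1/2, √3/2)`. -/
noncomputable def latticePoint (m n : ℤ) : EuclideanSpace ℝ (Fin 2) :=
  !₂[(m : ℝ) + (n : ℝ) / 2, (n : ℝ) * (Real.sqrt 3 / 2)]

/-- The faces of the tessellation: `(m, n, true)` points upward and `(m, n, false)` downward. -/
abbrev TessFace : Type := ℤ × ℤ × Bool

/-- The three vertices of a face of the tessellation. -/
noncomputable def TessFace.vertices : TessFace → Set (EuclideanSpace ℝ (Fin 2))
  | (m, n, true) => {latticePoint m n, latticePoint (m + 1) n, latticePoint m (n + 1)}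
  | (m, n, false) =>
      {latticePoint (m + 1) n, latticePoint m (n + 1), latticePoint (m + 1) (n + 1)}

/-- The closed equilateral triangle of side 1 spanned by a face of the tessellation. -/
noncomputable def TessFace.carrier (T : TessFace) : Set (EuclideanSpace ℝ (Fin 2)) :=
  convexHull ℝ T.vertices

/-- An abstract parity distribution on the plane (`0` is even and `1` is odd). -/
abbrev AbstractParityDistribution : Type := TessFace → ZMod 2

/-! ### The equilateral triangle of side 1, in barycentric coordinates -/

/-- The Euclidean distance between two points of the equilateral triangle of side 1. -/
noncomputable def triangleDist (a b : stdSimplex ℝ (Fin 3)) : ℝ :=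
  Real.sqrt ((∑ i, (a.1 i - b.1 i) ^ 2) / 2)

/-- `IsSidePoint i t a`: `a` is the point at distance `t` from the corner `i` on the side from the
corner `i` to the corner `i + 1`. -/
def IsSidePoint (i : Fin 3) (t : ℝ) (a : stdSimplex ℝ (Fin 3)) : Prop :=
  a.1 i = 1 - t ∧ a.1 (i + 1) = t ∧ a.1 (i + 2) = 0

namespace TriangleComplex

/-! ### Links and Moebius–Kantor complexes -/

/-- The vertex at the corner `i` of the face `f`. -/
def cornerVertex (K : TriangleComplex.{u}) (f : K.F) (i : Fin 3) : K.V := K.src (K.bd f i)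

/-- The two link vertices (oriented edges issuing from the corner) joined by the link edge which
the corner `i` of the face `f` determines. -/
def cornerEnds (K : TriangleComplex.{u}) (f : K.F) (i : Fin 3) : Sym2 K.D :=
  s(K.bd f i, K.rev (K.bd f (i + 2)))

/-- The link at `x`: its vertices are the oriented edges issuing from `x`, its edges are the
corners of faces at `x`. -/
def link (K : TriangleComplex.{u}) (x : K.V) : SimpleGraph {d : K.D // K.src d = x} where
  Adj d e := d ≠ e ∧ ∃ f i, K.cornerEnds f i = s(d.1, e.1)
  symm := ⟨fun _ _ h => ⟨h.1.symm, by
    obtain ⟨f, i, hfi⟩ := h.2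
    exact ⟨f, i, hfi.trans Sym2.eq_swap⟩⟩⟩
  loopless := ⟨fun _ h => h.1 rfl⟩

/-- A Moebius–Kantor complex: the links have neither loops nor multiple edges, and they are
isomorphic to the Moebius–Kantor graph. -/
structure IsMoebiusKantor (K : TriangleComplex.{u}) : Prop where
  no_loop : ∀ f i, ¬ (K.cornerEnds f i).IsDiag
  no_multi : ∀ f i g j, K.cornerEnds f i = K.cornerEnds g j → f = g ∧ i = j
  link_iso : ∀ x, Nonempty (K.link x ≃g moebiusKantorGraph)

/-! ### Geometric realization -/

/-- The gluing of the triangles `{f} × stdSimplex ℝ (Fin 3)` along their sides and corners. -/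
inductive Glue (K : TriangleComplex.{u}) :
    K.F × stdSimplex ℝ (Fin 3) → K.F × stdSimplex ℝ (Fin 3) → Prop
  | side (f g : K.F) (i j : Fin 3) (t : ℝ) (a b : stdSimplex ℝ (Fin 3))
      (h : K.bd f i = K.bd g j) (ha : IsSidePoint i t a) (hb : IsSidePoint j t b) :
      Glue K (f, a) (g, b)
  | side_rev (f g : K.F) (i j : Fin 3) (t : ℝ) (a b : stdSimplex ℝ (Fin 3))
      (h : K.bd f i = K.rev (K.bd g j)) (ha : IsSidePoint i t a)
      (hb : IsSidePoint j (1 - t) b) : Glue K (f, a) (g, b)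
  | corner (f g : K.F) (i j : Fin 3) (a b : stdSimplex ℝ (Fin 3))
      (h : K.cornerVertex f i = K.cornerVertex g j) (ha : a.1 i = 1) (hb : b.1 j = 1) :
      Glue K (f, a) (g, b)

/-- The geometric realization (every edge and vertex of a Moebius–Kantor complex lies in a
face, so it is enough to glue the faces). -/
def Realization (K : TriangleComplex.{u}) : Type u := Quot K.Glue

/-- The point of the realization given by a point of a face. -/
def point (K : TriangleComplex.{u}) (f : K.F) (a : stdSimplex ℝ (Fin 3)) : K.Realization :=
  Quot.mk K.Glue (f, a)

/-- The closed face `f` in the realization. -/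
def faceSet (K : TriangleComplex.{u}) (f : K.F) : Set K.Realization := Set.range (K.point f)

/-- The least distance between two points measured inside a common face (`⊤` if there is no
common face). -/
noncomputable def localDist (K : TriangleComplex.{u}) (x y : K.Realization) : ENNReal :=
  ⨅ (f : K.F) (a : stdSimplex ℝ (Fin 3)) (b : stdSimplex ℝ (Fin 3))
    (_ : K.point f a = x ∧ K.point f b = y), ENNReal.ofReal (triangleDist a b)

/-- The intrinsic metric of the piecewise Euclidean complex: the infimum of the lengths of the
strings from `x` to `y`, consecutive points of which lie in a common face. -/
noncomputable def intrinsicDist (K : TriangleComplex.{u}) (x y : K.Realization) : ENNReal :=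
  ⨅ (n : ℕ) (c : Fin (n + 1) → K.Realization) (_ : c 0 = x ∧ c (Fin.last n) = y),
    ∑ k : Fin n, K.localDist (c k.castSucc) (c k.succ)

/-- An isometric embedding of the Euclidean plane into the complex. -/
def IsIsometricEmbedding (K : TriangleComplex.{u})
    (φ : EuclideanSpace ℝ (Fin 2) → K.Realization) : Prop :=
  ∀ u v, K.intrinsicDist (φ u) (φ v) = edist u v

/-- A flat: the image of an isometric embedding of the Euclidean plane. -/
def IsFlat (K : TriangleComplex.{u}) (P : Set K.Realization) : Prop :=
  ∃ φ, K.IsIsometricEmbedding φ ∧ Set.range φ = P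

/-! ### Parity of faces -/

/-- A large triangle containing `f`: for every side `i` of `f`, another triangle, attached by one
of its sides to the same edge. (The comparison is between pairs (face, side), so it also makes
sense for a face two sides of which are identified.) -/
structure LargeTriangle (K : TriangleComplex.{u}) (f : K.F) where
  face : Fin 3 → K.F
  side : Fin 3 → Fin 3
  ne : ∀ i, (face i, side i) ≠ (f, i)
  glued : ∀ i, K.bd (face i) (side i) = K.bd f i ∨ K.bd (face i) (side i) = K.rev (K.bd f i)

open Classical in
/-- If `d` is the side `j` of `g`, in one of its two orientations, then `otherDart g j d` is the
second edge of `g` issuing from the origin of `d`. -/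
noncomputable def otherDart (K : TriangleComplex.{u}) (g : K.F) (j : Fin 3) (d : K.D) : K.D :=
  if K.bd g j = d then K.rev (K.bd g (j + 2)) else K.bd g (j + 1)

theorem src_rev_bd (K : TriangleComplex.{u}) (f : K.F) (i : Fin 3) :
    K.src (K.rev (K.bd f (i + 2))) = K.cornerVertex f i := by
  rw [K.bd_closed, add_assoc, show (2 + 1 : Fin 3) = 0 from rfl, add_zero]
  rfl

theorem src_otherDart (K : TriangleComplex.{u}) (g : K.F) (j : Fin 3) (d : K.D)
    (h : K.bd g j = d ∨ K.bd g j = K.rev d) : K.src (K.otherDart g j d) = K.src d := by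
  unfold otherDart
  split_ifs with h1
  · rw [K.src_rev_bd, ← h1]
    rfl
  · have h2 := h.resolve_left h1
    rw [← K.bd_closed, h2, K.rev_rev]

/-- The root at the corner `i` of `f` determined by a large triangle: it crosses the triangle
attached to the side `i + 2` (which ends at the corner `i`), then `f`, then the triangle attached
to the side `i`. -/
noncomputable def LargeTriangle.root {K : TriangleComplex.{u}} {f : K.F} (τ : K.LargeTriangle f)
    (i : Fin 3) : Fin 4 → {d : K.D // K.src d = K.cornerVertex f i} :=
  ![⟨K.otherDart (τ.face (i + 2)) (τ.side (i + 2)) (K.rev (K.bd f (i + 2))),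
      (K.src_otherDart _ _ _ (by rw [K.rev_rev]; exact (τ.glued (i + 2)).symm)).trans
        (K.src_rev_bd f i)⟩,
    ⟨K.rev (K.bd f (i + 2)), K.src_rev_bd f i⟩,
    ⟨K.bd f i, rfl⟩,
    ⟨K.otherDart (τ.face i) (τ.side i) (K.bd f i), K.src_otherDart _ _ _ (τ.glued i)⟩]

/-- The number of roots of rank 2 among the three roots which a large triangle determines. -/
noncomputable def LargeTriangle.rankTwoCount {K : TriangleComplex.{u}} {f : K.F}
    (τ : K.LargeTriangle f) : ℕ :=
  {i : Fin 3 | rootRank (K.link (K.cornerVertex f i)) (τ.root i) = 2}.ncard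

open Classical in
/-- The parity of a face: the parity of the number of roots of rank 2 in a large triangle
containing it (in a Moebius–Kantor complex, this does not depend on the large triangle). -/
noncomputable def parity (K : TriangleComplex.{u}) (f : K.F) : ZMod 2 :=
  if ∃ τ : K.LargeTriangle f, Odd τ.rankTwoCount then 1 else 0

/-! ### Realization of parity distributions -/

/-- `p` is the parity distribution of the flat `P`: for some isometric parametrization of `P` by
the plane which carries the faces of the tessellation of the plane to faces of the complex,
`p T` is the parity of the image of `T`. -/
def IsParityDistributionOf (K : TriangleComplex.{u}) (p : AbstractParityDistribution)
    (P : Set K.Realization) : Prop :=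
  ∃ φ, K.IsIsometricEmbedding φ ∧ Set.range φ = P ∧
    ∀ T : TessFace, ∃ f : K.F, φ '' T.carrier = K.faceSet f ∧ p T = K.parity f

/-- `p` is realized in `K`: it is the parity distribution of some flat of `K`. -/
def Realizes (K : TriangleComplex.{u}) (p : AbstractParityDistribution) : Prop :=
  ∃ P : Set K.Realization, K.IsFlat P ∧ K.IsParityDistributionOf p P

end TriangleComplex

/-! The proof is a count. A flat meets the link of each of its vertices in a hexagon. Each of the
six angles at the vertex carries the root running over it and its two neighbouring angles. Vertical
angles carry roots with the same endpoints, so there are three pairs of angles to consider. A finite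
check in the Moebius–Kantor graph (`moebiusKantorGraph.hexagon`) shows that exactly two of the pairs
have rank 2 and the third has rank 3/2.

So the ranks in a flat are encoded by one label in `Fin 3` per vertex, naming the exceptional pair
(`exists_label`), and the labels at its three corners determine the parity of a face
(`exists_parity_eq`). A rhombus with `10 × 10` vertices has `2 · 9 · 9 = 162` faces, and `3 ^ 100 <
2 ^ 162`, so some distribution comes from no labelling (`exists_ne_parityOfLabels`). The rule from
labels to parities does not mention the complex, so one distribution serves for all complexes.

Two reductions carry this. The parity does not depend on the large triangle: exchanging the triangle
on one side changes the rank at exactly the two corners of that side (`rankTwoCount_cast_eq`), so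
parities can be computed with the large triangles inside the flat. And an isometric embedding
carrying tessellation faces to faces is affine on each of them (`exists_perm_of_le_triangleDist`),
hence faithful on oriented edges (`edge_eq_iff`), which makes the problem combinatorial. -/

/-! ### Paths of length three in the Moebius–Kantor graph -/

namespace SimpleGraph

/-- Every neighbour of `a` is at distance two from `d`. For vertices `a` and `d` at distance three
in the Moebius–Kantor graph this says that the roots from `a` to `d` have rank 2. -/
def IsFullPair {W : Type u} (G : SimpleGraph W) (a d : W) : Prop :=
  ∀ b, G.Adj a b → ∃ c, G.Adj b c ∧ G.Adj c d

theorem IsFullPair.map {W : Type u} {W' : Type*} {G : SimpleGraph W} {H : SimpleGraph W'}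
    (e : G ≃g H) {a d : W} (h : G.IsFullPair a d) : H.IsFullPair (e a) (e d) := by
  intro b hb
  obtain ⟨c, hc, hd⟩ := h (e.symm b) (by simpa using e.symm.map_adj_iff.2 hb)
  exact ⟨e c, by simpa using e.map_adj_iff.2 hc, e.map_adj_iff.2 hd⟩

theorem isFullPair_iso_iff {W : Type u} {W' : Type*} {G : SimpleGraph W} {H : SimpleGraph W'}
    (e : G ≃g H) {a d : W} : H.IsFullPair (e a) (e d) ↔ G.IsFullPair a d :=
  ⟨fun h => by simpa using h.map e.symm, fun h => h.map e⟩

end SimpleGraph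

/-! ### Finite checks in the generalized Petersen graph `G(8,3)` -/

namespace moebiusKantorGraph

instance : DecidableRel moebiusKantorGraph.Adj := fun v w =>
  inferInstanceAs (Decidable (v ≠ w ∧ (((v.2 = false ∧ w.2 = false ∧ w.1 = v.1 + 1) ∨
    (v.2 = true ∧ w.2 = true ∧ w.1 = v.1 + 3) ∨
    (v.2 = false ∧ w.2 = true ∧ w.1 = v.1)) ∨ ((w.2 = false ∧ v.2 = false ∧ v.1 = w.1 + 1) ∨
    (w.2 = true ∧ v.2 = true ∧ v.1 = w.1 + 3) ∨
    (w.2 = false ∧ v.2 = true ∧ v.1 = w.1)))))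

instance (a d : ZMod 8 × Bool) : Decidable (moebiusKantorGraph.IsFullPair a d) :=
  inferInstanceAs (Decidable (∀ b, moebiusKantorGraph.Adj a b →
    ∃ c, moebiusKantorGraph.Adj b c ∧ moebiusKantorGraph.Adj c d))

-- The graph has no cycles of length 3, 4 or 5, so a path of length three without backtracking is
-- geodesic.
set_option synthInstance.maxHeartbeats 400000 in
set_option synthInstance.maxSize 2000 in
theorem path_three : ∀ a b, moebiusKantorGraph.Adj a b → ∀ c, moebiusKantorGraph.Adj b c → a ≠ c →
    ¬ moebiusKantorGraph.Adj a c ∧ ∀ d, moebiusKantorGraph.Adj c d → b ≠ d →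
      a ≠ d ∧ ¬ moebiusKantorGraph.Adj a d ∧
        ∀ x, moebiusKantorGraph.Adj a x → ¬ moebiusKantorGraph.Adj x d := by
  decide +kernel

theorem degree_eq : ∀ a, moebiusKantorGraph.degree a = 3 := by decide +kernel

/-- With `q = 2`, three paths between the ends mean rank 2 and two paths mean rank 3/2. -/
theorem card_paths : ∀ a b, moebiusKantorGraph.Adj a b → ∀ c, moebiusKantorGraph.Adj b c → a ≠ c →
    ∀ d, moebiusKantorGraph.Adj c d → b ≠ d →
      (Finset.univ.filter fun p : (ZMod 8 × Bool) × (ZMod 8 × Bool) =>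
        moebiusKantorGraph.Adj a p.1 ∧ moebiusKantorGraph.Adj p.1 p.2 ∧
          moebiusKantorGraph.Adj p.2 d).card =
      if moebiusKantorGraph.IsFullPair a d then 3 else 2 := by
  decide +kernel

/-- Fix the middle edge of a root: replacing one end by the other choice changes the rank, replacing
both ends preserves it. The invariance of parity rests on this. -/
theorem flip : ∀ b c, moebiusKantorGraph.Adj b c → ∀ a, moebiusKantorGraph.Adj a b → a ≠ c →
    ∀ a', moebiusKantorGraph.Adj a' b → a' ≠ c → ∀ d, moebiusKantorGraph.Adj c d → b ≠ d →
    ∀ d', moebiusKantorGraph.Adj c d' → b ≠ d' →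
      ((moebiusKantorGraph.IsFullPair a d ↔ moebiusKantorGraph.IsFullPair a' d') ↔
        (a = a' ↔ d = d')) := by
  decide +kernel

/-- `IsFullPair` is asymmetric as defined, while vertical angles of a flat give the same pair of
ends in opposite orders. -/
theorem isFullPair_symm : ∀ a b, moebiusKantorGraph.Adj a b → ∀ c, moebiusKantorGraph.Adj b c →
    a ≠ c → ∀ d, moebiusKantorGraph.Adj c d → b ≠ d →
      (moebiusKantorGraph.IsFullPair a d ↔ moebiusKantorGraph.IsFullPair d a) := by
  decide +kernel

-- The three pairs of opposite vertices of a 6-cycle: exactly two of them are full.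
set_option synthInstance.maxHeartbeats 400000 in
set_option synthInstance.maxSize 2000 in
theorem hexagon : ∀ a b, moebiusKantorGraph.Adj a b → ∀ c, moebiusKantorGraph.Adj b c → a ≠ c →
    ∀ d, moebiusKantorGraph.Adj c d → b ≠ d → ∀ f, moebiusKantorGraph.Adj f a → f ≠ b →
    ∀ e, moebiusKantorGraph.Adj d e → moebiusKantorGraph.Adj e f →
    ¬ (moebiusKantorGraph.IsFullPair f c ∧ moebiusKantorGraph.IsFullPair b e ∧
      moebiusKantorGraph.IsFullPair d a) ∧
    (moebiusKantorGraph.IsFullPair f c ∨ moebiusKantorGraph.IsFullPair b e) ∧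
    (moebiusKantorGraph.IsFullPair f c ∨ moebiusKantorGraph.IsFullPair d a) ∧
    (moebiusKantorGraph.IsFullPair b e ∨ moebiusKantorGraph.IsFullPair d a) := by
  decide +kernel

end moebiusKantorGraph

/-! ### Graphs isomorphic to the Moebius–Kantor graph -/

namespace SimpleGraph

variable {W : Type u} {G : SimpleGraph W}

theorem dist_eq_two (a b c : W) (hab : G.Adj a b) (hbc : G.Adj b c) (hac : a ≠ c)
    (h : ¬ G.Adj a c) : G.dist a c = 2 := by
  have h2 : G.edist a c = 2 := edist_eq_two_iff.2 ⟨hac, h, b, hab, hbc.symm⟩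
  simp [dist, h2]

theorem dist_eq_three (a b c d : W) (hab : G.Adj a b) (hbc : G.Adj b c) (hcd : G.Adj c d)
    (had : a ≠ d) (h : ¬ G.Adj a d) (h' : ∀ x, G.Adj a x → ¬ G.Adj x d) : G.dist a d = 3 := by
  have h1 : G.dist a d ≤ 3 := dist_le (.cons hab (.cons hbc (.cons hcd .nil)))
  have hr : G.Reachable a d := ⟨.cons hab (.cons hbc (.cons hcd .nil))⟩
  have h2 : 2 < G.edist a d := two_lt_edist_iff.2 ⟨had, h, by
    ext x
    simpa [mem_commonNeighbors] using fun hx hx' => h' x hx hx'.symm⟩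
  rw [← hr.coe_dist_eq_edist] at h2
  have : 2 < G.dist a d := by exact_mod_cast h2
  omega

theorem flip (e : G ≃g moebiusKantorGraph) {a a' b c d d' : W} (hab : G.Adj a b)
    (hab' : G.Adj a' b) (hbc : G.Adj b c) (hcd : G.Adj c d) (hcd' : G.Adj c d') (hac : a ≠ c)
    (hac' : a' ≠ c) (hbd : b ≠ d) (hbd' : b ≠ d') :
    (G.IsFullPair a d ↔ G.IsFullPair a' d') ↔ (a = a' ↔ d = d') := by
  have := moebiusKantorGraph.flip (e b) (e c) (e.map_adj_iff.2 hbc) (e a) (e.map_adj_iff.2 hab)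
    (by simpa) (e a') (e.map_adj_iff.2 hab') (by simpa) (e d) (e.map_adj_iff.2 hcd) (by simpa)
    (e d') (e.map_adj_iff.2 hcd') (by simpa)
  simpa [isFullPair_iso_iff] using this

theorem isFullPair_symm (e : G ≃g moebiusKantorGraph) {a b c d : W} (hab : G.Adj a b)
    (hbc : G.Adj b c) (hcd : G.Adj c d) (hac : a ≠ c) (hbd : b ≠ d) :
    G.IsFullPair a d ↔ G.IsFullPair d a := by
  have := moebiusKantorGraph.isFullPair_symm (e a) (e b) (e.map_adj_iff.2 hab) (e c)
    (e.map_adj_iff.2 hbc) (by simpa) (e d) (e.map_adj_iff.2 hcd) (by simpa)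
  simpa [isFullPair_iso_iff] using this

theorem hexagon (i : G ≃g moebiusKantorGraph) {a b c d e f : W} (hab : G.Adj a b)
    (hbc : G.Adj b c) (hcd : G.Adj c d) (hde : G.Adj d e) (hef : G.Adj e f) (hfa : G.Adj f a)
    (hac : a ≠ c) (hbd : b ≠ d) (hfb : f ≠ b) :
    ¬ (G.IsFullPair f c ∧ G.IsFullPair b e ∧ G.IsFullPair d a) ∧
      (G.IsFullPair f c ∨ G.IsFullPair b e) ∧ (G.IsFullPair f c ∨ G.IsFullPair d a) ∧
      (G.IsFullPair b e ∨ G.IsFullPair d a) := by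
  have := moebiusKantorGraph.hexagon (i a) (i b) (i.map_adj_iff.2 hab) (i c)
    (i.map_adj_iff.2 hbc) (by simpa) (i d) (i.map_adj_iff.2 hcd) (by simpa) (i f)
    (i.map_adj_iff.2 hfa) (by simpa) (i e) (i.map_adj_iff.2 hde) (i.map_adj_iff.2 hef)
  simpa only [isFullPair_iso_iff] using this

theorem path_three (e : G ≃g moebiusKantorGraph) {a b c : W} (hab : G.Adj a b)
    (hbc : G.Adj b c) (hac : a ≠ c) : ¬ G.Adj a c ∧ ∀ d, G.Adj c d → b ≠ d →
      a ≠ d ∧ ¬ G.Adj a d ∧ ∀ x, G.Adj a x → ¬ G.Adj x d := by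
  obtain ⟨h1, h2⟩ := moebiusKantorGraph.path_three (e a) (e b) (e.map_adj_iff.2 hab) (e c)
    (e.map_adj_iff.2 hbc) (by simpa)
  refine ⟨fun h => h1 (e.map_adj_iff.2 h), fun d hd hbd => ?_⟩
  obtain ⟨h3, h4, h5⟩ := h2 (e d) (e.map_adj_iff.2 hd) (by simpa)
  exact ⟨fun h => h3 (by rw [h]), fun h => h4 (e.map_adj_iff.2 h),
    fun x hx hx' => h5 (e x) (e.map_adj_iff.2 hx) (e.map_adj_iff.2 hx')⟩

theorem ncard_neighborSet (e : G ≃g moebiusKantorGraph) (a : W) :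
    (G.neighborSet a).ncard = 3 := by
  have h : e '' G.neighborSet a = moebiusKantorGraph.neighborSet (e a) := by
    ext x
    constructor
    · rintro ⟨y, hy, rfl⟩
      exact e.map_adj_iff.2 hy
    · intro hx
      exact ⟨e.symm x, by simpa using e.symm.map_adj_iff.2 hx, by simp⟩
  rw [← Set.ncard_image_of_injective _ e.injective, h, ← moebiusKantorGraph.degree_eq (e a),
    ← SimpleGraph.card_neighborFinset_eq_degree, ← Set.ncard_coe_finset, coe_neighborFinset]

theorem ncard_paths (e : G ≃g moebiusKantorGraph) {a b c d : W} (hab : G.Adj a b)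
    (hbc : G.Adj b c) (hcd : G.Adj c d) (hac : a ≠ c) (hbd : b ≠ d) [Decidable (G.IsFullPair a d)] :
    {p : W × W | G.Adj a p.1 ∧ G.Adj p.1 p.2 ∧ G.Adj p.2 d}.ncard =
      if G.IsFullPair a d then 3 else 2 := by
  have h := moebiusKantorGraph.card_paths (e a) (e b) (e.map_adj_iff.2 hab) (e c)
    (e.map_adj_iff.2 hbc) (by simpa) (e d) (e.map_adj_iff.2 hcd) (by simpa)
  simp only [isFullPair_iso_iff] at h
  have h' : Prod.map e e '' {p : W × W | G.Adj a p.1 ∧ G.Adj p.1 p.2 ∧ G.Adj p.2 d} =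
      (Finset.univ.filter fun p : (ZMod 8 × Bool) × (ZMod 8 × Bool) =>
        moebiusKantorGraph.Adj (e a) p.1 ∧ moebiusKantorGraph.Adj p.1 p.2 ∧
          moebiusKantorGraph.Adj p.2 (e d) : Finset _) := by
    ext ⟨x, y⟩
    simp only [Set.mem_image, Set.mem_ofPred_eq, Finset.coe_filter, Finset.mem_univ, true_and]
    constructor
    · rintro ⟨⟨x', y'⟩, ⟨h1, h2, h3⟩, h4⟩
      simp only [Prod.map_apply, Prod.mk.injEq] at h4
      rw [← h4.1, ← h4.2]
      exact ⟨e.map_adj_iff.2 h1, e.map_adj_iff.2 h2, e.map_adj_iff.2 h3⟩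
    · rintro ⟨h1, h2, h3⟩
      refine ⟨(e.symm x, e.symm y), ⟨?_, e.symm.map_adj_iff.2 h2, ?_⟩, by simp⟩
      · simpa using e.symm.map_adj_iff.2 h1
      · simpa using e.symm.map_adj_iff.2 h3
  rw [← Set.ncard_image_of_injective _ (e.injective.prodMap e.injective), h',
    Set.ncard_coe_finset]
  convert h

/-- By `path_three`, absence of backtracking already forces all the distances along the path. -/
theorem isRoot_iff (e : G ≃g moebiusKantorGraph) (α : Fin 4 → W) :
    IsRoot G α ↔ G.Adj (α 0) (α 1) ∧ G.Adj (α 1) (α 2) ∧ G.Adj (α 2) (α 3) ∧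
      α 0 ≠ α 2 ∧ α 1 ≠ α 3 := by
  constructor
  · intro h
    have h01 := h 0 1
    have h12 := h 1 2
    have h23 := h 2 3
    have h02 := h 0 2
    have h13 := h 1 3
    norm_num at h01 h12 h23 h02 h13
    refine ⟨h01, h12, h23, fun hh => ?_, fun hh => ?_⟩
    · simp [hh] at h02
    · simp [hh] at h13
  · rintro ⟨h01, h12, h23, h02, h13⟩
    have h3 := (path_three e h01 h12 h02).2 _ h23 h13
    have d01 := dist_eq_one_iff_adj.2 h01
    have d12 := dist_eq_one_iff_adj.2 h12
    have d23 := dist_eq_one_iff_adj.2 h23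
    have d02 := dist_eq_two _ _ _ h01 h12 h02 (path_three e h01 h12 h02).1
    have d13 := dist_eq_two _ _ _ h12 h23 h13 (path_three e h12 h23 h13).1
    have d03 := dist_eq_three _ _ _ _ h01 h12 h23 h3.1 h3.2.1 h3.2.2
    intro i j
    fin_cases i <;> fin_cases j <;>
      simp [d01, d12, d23, d02, d13, d03, dist_comm (u := α 1) (v := α 0),
        dist_comm (u := α 2) (v := α 1), dist_comm (u := α 3) (v := α 2),
        dist_comm (u := α 2) (v := α 0), dist_comm (u := α 3) (v := α 1),
        dist_comm (u := α 3) (v := α 0)]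

/-- A root with given ends is determined by its two inner vertices, and every path of length three
between those ends is a root. Hence `N(α)` is the number of paths minus one, `α` itself being one of
them. -/
theorem rootRank_eq_two_iff (e : G ≃g moebiusKantorGraph) (α : Fin 4 → W)
    (h01 : G.Adj (α 0) (α 1)) (h12 : G.Adj (α 1) (α 2)) (h23 : G.Adj (α 2) (α 3))
    (h02 : α 0 ≠ α 2) (h13 : α 1 ≠ α 3) :
    rootRank G α = 2 ↔ G.IsFullPair (α 0) (α 3) := by
  classical
  have hα : IsRoot G α := (isRoot_iff e α).2 ⟨h01, h12, h23, h02, h13⟩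
  have hn := ncard_paths e h01 h12 h23 h02 h13
  set S := {β : Fin 4 → W | IsRoot G β ∧ α ≠ β ∧ α 0 = β 0 ∧ α 3 = β 3} with hS
  have hins : (fun β : Fin 4 → W => (β 1, β 2)) '' insert α S =
      {p : W × W | G.Adj (α 0) p.1 ∧ G.Adj p.1 p.2 ∧ G.Adj p.2 (α 3)} := by
    ext ⟨b, c⟩
    constructor
    · rintro ⟨β, hβ, h⟩
      simp only [Prod.mk.injEq] at h
      rcases hβ with rfl | ⟨hr, -, h0, h3⟩
      · simpa [← h.1, ← h.2] using ⟨h01, h12, h23⟩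
      · obtain ⟨k1, k2, k3, -, -⟩ := (isRoot_iff e β).1 hr
        simpa [← h.1, ← h.2, h0, h3] using ⟨k1, k2, k3⟩
    · rintro ⟨k1, k2, k3⟩
      refine ⟨![α 0, b, c, α 3], ?_, rfl⟩
      have hfar := (path_three e h01 h12 h02).2 _ h23 h13
      have hr : IsRoot G ![α 0, b, c, α 3] := by
        rw [isRoot_iff e]
        refine ⟨k1, k2, k3, ?_, ?_⟩
        · rintro (h : α 0 = c)
          exact hfar.2.1 (h ▸ k3)
        · rintro (h : b = α 3)
          exact hfar.2.1 (h ▸ k1)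
      by_cases hh : α = ![α 0, b, c, α 3]
      · exact Or.inl hh.symm
      · exact Or.inr ⟨hr, hh, rfl, rfl⟩
  have hinj : Set.InjOn (fun β : Fin 4 → W => (β 1, β 2)) (insert α S) := by
    have key : ∀ β ∈ insert α S, α 0 = β 0 ∧ α 3 = β 3 := by
      rintro β (rfl | h)
      · exact ⟨rfl, rfl⟩
      · exact h.2.2
    intro β hβ γ hγ h
    simp only [Prod.mk.injEq] at h
    ext i
    fin_cases i
    · exact (key β hβ).1.symm.trans (key γ hγ).1
    · exact h.1
    · exact h.2
    · exact (key β hβ).2.symm.trans (key γ hγ).2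
  -- An infinite set would have `ncard` equal to 0, whereas the image has 2 or 3 elements.
  have hfin : (insert α S).Finite := by
    refine Set.Finite.of_finite_image (Set.finite_of_ncard_pos ?_) hinj
    rw [hins, hn]
    split_ifs <;> norm_num
  rw [← hins, hinj.ncard_image,
    Set.ncard_insert_of_notMem (fun h => h.2.1 rfl) (hfin.subset (Set.subset_insert _ _))] at hn
  rw [rootRank, ncard_neighborSet e, ← hS]
  split_ifs at hn with hf
  · have : S.ncard = 2 := by omega
    simp only [this, hf, iff_true]
    norm_num
  · have : S.ncard = 1 := by omega
    simp only [this, hf, iff_false]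
    norm_num

end SimpleGraph

namespace TriangleComplex

variable {K : TriangleComplex.{u}}

/-! ### The oriented edges of a face and their links -/

/-- The oriented edge of the face `f` from the corner `i` to the corner `j`, for `i ≠ j`. -/
def dart (K : TriangleComplex.{u}) (f : K.F) (i j : Fin 3) : K.D :=
  if j = i + 1 then K.bd f i else K.rev (K.bd f j)

theorem Fin3.cases_of_ne {i j k : Fin 3} (hij : i ≠ j) (hik : i ≠ k) (hjk : j ≠ k) :
    (j = i + 1 ∧ k = i + 2) ∨ (j = i + 2 ∧ k = i + 1) := by
  revert i j k
  decide

@[simp] theorem dart_add_one (f : K.F) (i : Fin 3) : K.dart f i (i + 1) = K.bd f i := by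
  simp [dart]

@[simp] theorem dart_add_two (f : K.F) (i : Fin 3) :
    K.dart f i (i + 2) = K.rev (K.bd f (i + 2)) := by
  have : i + 2 ≠ i + 1 := by revert i; decide
  simp [dart, this]

theorem add_one_dart (f : K.F) (i : Fin 3) : K.dart f (i + 1) i = K.rev (K.bd f i) := by
  have : i ≠ i + 1 + 1 := by revert i; decide
  simp [dart, this]

theorem cornerEnds_eq (f : K.F) {i j k : Fin 3} (hij : i ≠ j) (hik : i ≠ k) (hjk : j ≠ k) :
    K.cornerEnds f i = s(K.dart f i j, K.dart f i k) := by
  rcases Fin3.cases_of_ne hij hik hjk with ⟨rfl, rfl⟩ | ⟨rfl, rfl⟩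
  · simp [cornerEnds]
  · rw [Sym2.eq_swap]
    simp [cornerEnds]

/-- The disjoint union of all links. -/
def dartGraph (K : TriangleComplex.{u}) : SimpleGraph K.D where
  Adj d e := d ≠ e ∧ ∃ f i, K.cornerEnds f i = s(d, e)
  symm := ⟨fun _ _ h => ⟨h.1.symm, by
    obtain ⟨f, i, hfi⟩ := h.2
    exact ⟨f, i, hfi.trans Sym2.eq_swap⟩⟩⟩
  loopless := ⟨fun _ h => h.1 rfl⟩

theorem src_eq_of_dartGraph_adj {d e : K.D} (h : K.dartGraph.Adj d e) : K.src e = K.src d := by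
  obtain ⟨-, f, i, h⟩ := h
  have hs : ∀ x ∈ K.cornerEnds f i, K.src x = K.cornerVertex f i := by
    intro x hx
    rcases Sym2.mem_iff.1 hx with rfl | rfl
    · rfl
    · exact K.src_rev_bd f i
  rw [hs e (by rw [h]; simp), hs d (by rw [h]; simp)]

theorem link_adj_iff {x : K.V} (d e : {d : K.D // K.src d = x}) :
    (K.link x).Adj d e ↔ K.dartGraph.Adj d.1 e.1 :=
  and_congr_left' (not_congr Subtype.ext_iff)

/-- Adjacent darts have the same origin, so the paths in question never leave the link; one may work
with bare darts instead of subtypes. -/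
theorem isFullPair_link_iff {x : K.V} (a d : {d : K.D // K.src d = x}) :
    (K.link x).IsFullPair a d ↔ K.dartGraph.IsFullPair a.1 d.1 := by
  constructor
  · intro h b hb
    obtain ⟨c, hc, hd⟩ := h ⟨b, (src_eq_of_dartGraph_adj hb).trans a.2⟩ ((link_adj_iff _ _).2 hb)
    exact ⟨c.1, (link_adj_iff _ _).1 hc, (link_adj_iff _ _).1 hd⟩
  · intro h b hb
    obtain ⟨c, hc, hd⟩ := h b.1 ((link_adj_iff _ _).1 hb)
    exact ⟨⟨c, (src_eq_of_dartGraph_adj hc).trans b.2⟩, (link_adj_iff _ _).2 hc,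
      (link_adj_iff _ _).2 hd⟩

/-! ### Transfer of the finite checks to the union of the links -/

namespace IsMoebiusKantor

theorem flip (hK : K.IsMoebiusKantor) {a a' b c d d' : K.D} (hab : K.dartGraph.Adj a b)
    (hab' : K.dartGraph.Adj a' b) (hbc : K.dartGraph.Adj b c) (hcd : K.dartGraph.Adj c d)
    (hcd' : K.dartGraph.Adj c d') (hac : a ≠ c) (hac' : a' ≠ c) (hbd : b ≠ d) (hbd' : b ≠ d') :
    (K.dartGraph.IsFullPair a d ↔ K.dartGraph.IsFullPair a' d') ↔ (a = a' ↔ d = d') := by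
  obtain ⟨e⟩ := hK.link_iso (K.src b)
  have sc := src_eq_of_dartGraph_adj hbc
  let a₁ : {d : K.D // K.src d = K.src b} := ⟨a, (src_eq_of_dartGraph_adj hab).symm⟩
  let a₂ : {d : K.D // K.src d = K.src b} := ⟨a', (src_eq_of_dartGraph_adj hab').symm⟩
  let b₁ : {d : K.D // K.src d = K.src b} := ⟨b, rfl⟩
  let c₁ : {d : K.D // K.src d = K.src b} := ⟨c, sc⟩
  let d₁ : {d : K.D // K.src d = K.src b} := ⟨d, (src_eq_of_dartGraph_adj hcd).trans sc⟩
  let d₂ : {d : K.D // K.src d = K.src b} := ⟨d', (src_eq_of_dartGraph_adj hcd').trans sc⟩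
  have := SimpleGraph.flip e (a := a₁) (a' := a₂) (b := b₁) (c := c₁) (d := d₁) (d' := d₂)
    ((link_adj_iff _ _).2 hab) ((link_adj_iff _ _).2 hab')
    ((link_adj_iff _ _).2 hbc) ((link_adj_iff _ _).2 hcd) ((link_adj_iff _ _).2 hcd')
    (by simpa [a₁, c₁]) (by simpa [a₂, c₁]) (by simpa [b₁, d₁])
    (by simpa [b₁, d₂])
  simpa [isFullPair_link_iff, a₁, a₂, d₁, d₂] using this

theorem isFullPair_symm (hK : K.IsMoebiusKantor) {a b c d : K.D} (hab : K.dartGraph.Adj a b)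
    (hbc : K.dartGraph.Adj b c) (hcd : K.dartGraph.Adj c d) (hac : a ≠ c) (hbd : b ≠ d) :
    K.dartGraph.IsFullPair a d ↔ K.dartGraph.IsFullPair d a := by
  obtain ⟨e⟩ := hK.link_iso (K.src b)
  have sc := src_eq_of_dartGraph_adj hbc
  let a₁ : {d : K.D // K.src d = K.src b} := ⟨a, (src_eq_of_dartGraph_adj hab).symm⟩
  let b₁ : {d : K.D // K.src d = K.src b} := ⟨b, rfl⟩
  let c₁ : {d : K.D // K.src d = K.src b} := ⟨c, sc⟩
  let d₁ : {d : K.D // K.src d = K.src b} := ⟨d, (src_eq_of_dartGraph_adj hcd).trans sc⟩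
  have := SimpleGraph.isFullPair_symm e (a := a₁) (b := b₁) (c := c₁) (d := d₁)
    ((link_adj_iff _ _).2 hab) ((link_adj_iff _ _).2 hbc) ((link_adj_iff _ _).2 hcd)
    (by simpa [a₁, c₁]) (by simpa [b₁, d₁])
  simpa [isFullPair_link_iff, a₁, d₁] using this

theorem hexagon (hK : K.IsMoebiusKantor) {a b c d e f : K.D} (hab : K.dartGraph.Adj a b)
    (hbc : K.dartGraph.Adj b c) (hcd : K.dartGraph.Adj c d) (hde : K.dartGraph.Adj d e)
    (hef : K.dartGraph.Adj e f) (hfa : K.dartGraph.Adj f a)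
    (hac : a ≠ c) (hbd : b ≠ d) (hfb : f ≠ b) :
    ¬ (K.dartGraph.IsFullPair f c ∧ K.dartGraph.IsFullPair b e ∧ K.dartGraph.IsFullPair d a) ∧
      (K.dartGraph.IsFullPair f c ∨ K.dartGraph.IsFullPair b e) ∧
      (K.dartGraph.IsFullPair f c ∨ K.dartGraph.IsFullPair d a) ∧
      (K.dartGraph.IsFullPair b e ∨ K.dartGraph.IsFullPair d a) := by
  obtain ⟨i⟩ := hK.link_iso (K.src a)
  have sb := src_eq_of_dartGraph_adj hab
  have sc := (src_eq_of_dartGraph_adj hbc).trans sb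
  have sd := (src_eq_of_dartGraph_adj hcd).trans sc
  have se := (src_eq_of_dartGraph_adj hde).trans sd
  have sf := (src_eq_of_dartGraph_adj hef).trans se
  let a₁ : {d : K.D // K.src d = K.src a} := ⟨a, rfl⟩
  let b₁ : {d : K.D // K.src d = K.src a} := ⟨b, sb⟩
  let c₁ : {d : K.D // K.src d = K.src a} := ⟨c, sc⟩
  let d₁ : {d : K.D // K.src d = K.src a} := ⟨d, sd⟩
  let e₁ : {d : K.D // K.src d = K.src a} := ⟨e, se⟩
  let f₁ : {d : K.D // K.src d = K.src a} := ⟨f, sf⟩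
  have := SimpleGraph.hexagon i (a := a₁) (b := b₁) (c := c₁) (d := d₁) (e := e₁) (f := f₁)
    ((link_adj_iff _ _).2 hab) ((link_adj_iff _ _).2 hbc) ((link_adj_iff _ _).2 hcd)
    ((link_adj_iff _ _).2 hde) ((link_adj_iff _ _).2 hef) ((link_adj_iff _ _).2 hfa)
    (by simpa [a₁, c₁]) (by simpa [b₁, d₁]) (by simpa [f₁, b₁])
  simpa only [isFullPair_link_iff] using this

theorem dart_ne (hK : K.IsMoebiusKantor) (f : K.F) {i j k : Fin 3} (hij : i ≠ j) (hik : i ≠ k)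
    (hjk : j ≠ k) : K.dart f i j ≠ K.dart f i k := by
  intro h
  apply hK.no_loop f i
  rw [cornerEnds_eq f hij hik hjk, h]
  exact Sym2.diag_isDiag _

theorem dartGraph_adj (hK : K.IsMoebiusKantor) (f : K.F) {i j k : Fin 3} (hij : i ≠ j)
    (hik : i ≠ k) (hjk : j ≠ k) : K.dartGraph.Adj (K.dart f i j) (K.dart f i k) :=
  ⟨hK.dart_ne f hij hik hjk, f, i, cornerEnds_eq f hij hik hjk⟩

end IsMoebiusKantor

/-! ### Large triangles -/

/-- The side `s` is opposite to the corner `s + 2`. This replaces the case distinction on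
orientation in `otherDart` by a choice of corners. -/
theorem exists_dart_of_side (g : K.F) (s : Fin 3) (d : K.D)
    (h : K.bd g s = d ∨ K.bd g s = K.rev d) : ∃ i j : Fin 3, i ≠ j ∧ i ≠ s + 2 ∧ j ≠ s + 2 ∧
      d = K.dart g i j ∧ K.otherDart g s d = K.dart g i (s + 2) := by
  rcases h with h | h
  · refine ⟨s, s + 1, by simp, by simp, by simp, by simp [h], ?_⟩
    simp [otherDart, h]
  · refine ⟨s + 1, s, by simp, by simp, by simp, by rw [add_one_dart, h, K.rev_rev], ?_⟩
    rw [otherDart, if_neg (by rw [h]; exact K.rev_ne d),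
      show s + 2 = s + 1 + 1 by rw [add_assoc]; rfl, dart_add_one]

theorem otherDart_bd (f : K.F) (i : Fin 3) :
    K.otherDart f i (K.bd f i) = K.rev (K.bd f (i + 2)) := by
  simp [otherDart]

theorem otherDart_rev_bd (f : K.F) (i : Fin 3) :
    K.otherDart f i (K.rev (K.bd f i)) = K.bd f (i + 1) := by
  rw [otherDart, if_neg (K.rev_ne _).symm]

theorem otherDart_dart (g : K.F) {i j k s : Fin 3} (hij : i ≠ j) (hik : i ≠ k) (hjk : j ≠ k)
    (hs : k = s + 2) : K.otherDart g s (K.dart g i j) = K.dart g i k := by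
  have h : (i = s ∧ j = s + 1) ∨ (i = s + 1 ∧ j = s) := by
    revert i j k s
    decide
  rcases h with ⟨rfl, rfl⟩ | ⟨rfl, rfl⟩
  · rw [hs, dart_add_one, otherDart_bd, dart_add_two]
  · rw [hs, add_one_dart, otherDart_rev_bd, show j + 2 = j + 1 + 1 by rw [add_assoc]; rfl,
      dart_add_one]

theorem IsMoebiusKantor.adj_otherDart (hK : K.IsMoebiusKantor) (g : K.F) (s : Fin 3) (d : K.D)
    (h : K.bd g s = d ∨ K.bd g s = K.rev d) : K.dartGraph.Adj d (K.otherDart g s d) := by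
  obtain ⟨i, j, hij, hi, hj, h1, h2⟩ := exists_dart_of_side g s d h
  rw [h2, h1]
  exact hK.dartGraph_adj g hij hi hj

/-- Links have no multiple edges, so a link edge determines its face and corner. Hence changing the
attached triangle is the same as changing the end of the root. -/
theorem IsMoebiusKantor.otherDart_inj (hK : K.IsMoebiusKantor) {g g' : K.F} {s s' : Fin 3}
    {d : K.D} (h : K.bd g s = d ∨ K.bd g s = K.rev d)
    (h' : K.bd g' s' = d ∨ K.bd g' s' = K.rev d) :
    K.otherDart g s d = K.otherDart g' s' d ↔ (g, s) = (g', s') := by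
  constructor
  · intro heq
    obtain ⟨i, j, hij, hi, hj, h1, h2⟩ := exists_dart_of_side g s d h
    obtain ⟨i', j', hij', hi', hj', h1', h2'⟩ := exists_dart_of_side g' s' d h'
    obtain ⟨rfl, rfl⟩ := hK.no_multi g i g' i' (by
      rw [cornerEnds_eq g hij hi hj, cornerEnds_eq g' hij' hi' hj', ← h1, ← h1', ← h2, ← h2', heq])
    by_cases hjj : j = j'
    · subst hjj
      have : s = s' := by
        clear heq h1 h2 h1' h2' h h'
        revert i j s s'
        decide
      rw [this]
    · exact absurd (h1.symm.trans h1') (hK.dart_ne g hij hij' hjj)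
  · intro h
    simp only [Prod.mk.injEq] at h
    rw [h.1, h.2]

-- Over `ZMod 2` the hypothesis reads `y + z = x + x'`.
open Classical in
theorem boole_eq_of_flip {x x' y z : Prop} (h : (y ↔ z) ↔ (x ↔ x')) :
    (if y then (1 : ZMod 2) else 0) =
      (if z then 1 else 0) + (if x then 1 else 0) + (if x' then 1 else 0) := by
  have h' : y ↔ (z ↔ (x ↔ x')) := by tauto
  rw [if_congr h' rfl rfl]
  by_cases hx : x <;> by_cases hx' : x' <;> by_cases hz : z <;> simp [hx, hx', hz] <;> decide

-- Each `x` enters at two corners, so its contributions cancel modulo 2.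
open Classical in
theorem sum_boole_eq_of_flip {x₀ x₁ x₂ y₀ y₁ y₂ z₀ z₁ z₂ : Prop}
    (h₀ : (y₀ ↔ z₀) ↔ (x₂ ↔ x₀)) (h₁ : (y₁ ↔ z₁) ↔ (x₀ ↔ x₁)) (h₂ : (y₂ ↔ z₂) ↔ (x₁ ↔ x₂)) :
    (if y₀ then (1 : ZMod 2) else 0) + (if y₁ then 1 else 0) + (if y₂ then 1 else 0) =
      (if z₀ then 1 else 0) + (if z₁ then 1 else 0) + (if z₂ then 1 else 0) := by
  rw [boole_eq_of_flip h₀, boole_eq_of_flip h₁, boole_eq_of_flip h₂]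
  have two : (2 : ZMod 2) = 0 := rfl
  linear_combination ((if x₀ then (1 : ZMod 2) else 0) + (if x₁ then 1 else 0) +
    (if x₂ then 1 else 0)) * two

/-! ### Independence of the parity from the large triangle -/

namespace LargeTriangle

variable {f : K.F}

/-- The initial vertex of the root at the corner `i`. -/
noncomputable def rootStart (τ : K.LargeTriangle f) (i : Fin 3) : K.D :=
  K.otherDart (τ.face (i + 2)) (τ.side (i + 2)) (K.rev (K.bd f (i + 2)))

/-- The final vertex of the root at the corner `i`. -/
noncomputable def rootEnd (τ : K.LargeTriangle f) (i : Fin 3) : K.D :=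
  K.otherDart (τ.face i) (τ.side i) (K.bd f i)

theorem glued_rev (τ : K.LargeTriangle f) (i : Fin 3) :
    K.bd (τ.face i) (τ.side i) = K.rev (K.bd f i) ∨
      K.bd (τ.face i) (τ.side i) = K.rev (K.rev (K.bd f i)) := by
  rw [K.rev_rev]
  exact (τ.glued i).symm

theorem adj_rootStart (hK : K.IsMoebiusKantor) (τ : K.LargeTriangle f) (i : Fin 3) :
    K.dartGraph.Adj (τ.rootStart i) (K.rev (K.bd f (i + 2))) :=
  (hK.adj_otherDart _ _ _ (τ.glued_rev (i + 2))).symm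

theorem adj_rootEnd (hK : K.IsMoebiusKantor) (τ : K.LargeTriangle f) (i : Fin 3) :
    K.dartGraph.Adj (K.bd f i) (τ.rootEnd i) :=
  hK.adj_otherDart _ _ _ (τ.glued i)

theorem adj_mid (hK : K.IsMoebiusKantor) (f : K.F) (i : Fin 3) :
    K.dartGraph.Adj (K.rev (K.bd f (i + 2))) (K.bd f i) := by
  have := hK.dartGraph_adj f (i := i) (j := i + 2) (k := i + 1) (by simp) (by simp) (by simp)
  simpa using this

theorem rootStart_ne (hK : K.IsMoebiusKantor) (τ : K.LargeTriangle f) (i : Fin 3) :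
    τ.rootStart i ≠ K.bd f i := by
  intro h
  have h1 := otherDart_rev_bd f (i + 2)
  rw [show i + 2 + 1 = i by rw [add_assoc]; exact add_zero i, ← h] at h1
  exact τ.ne (i + 2) ((hK.otherDart_inj (τ.glued_rev (i + 2)) (Or.inr (by rw [K.rev_rev]))).1
    h1.symm)

theorem ne_rootEnd (hK : K.IsMoebiusKantor) (τ : K.LargeTriangle f) (i : Fin 3) :
    K.rev (K.bd f (i + 2)) ≠ τ.rootEnd i := by
  intro h
  rw [← otherDart_bd f i] at h
  exact τ.ne i ((hK.otherDart_inj (τ.glued i) (Or.inl rfl)).1 h.symm)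

theorem rootRank_eq_two_iff (hK : K.IsMoebiusKantor) (τ : K.LargeTriangle f) (i : Fin 3) :
    rootRank (K.link (K.cornerVertex f i)) (τ.root i) = 2 ↔
      K.dartGraph.IsFullPair (τ.rootStart i) (τ.rootEnd i) := by
  obtain ⟨e⟩ := hK.link_iso (K.cornerVertex f i)
  have h02 := τ.rootStart_ne hK i
  have h13 := τ.ne_rootEnd hK i
  rw [SimpleGraph.rootRank_eq_two_iff e, isFullPair_link_iff]
  · rfl
  · exact (link_adj_iff _ _).2 (τ.adj_rootStart hK i)
  · exact (link_adj_iff _ _).2 (adj_mid hK f i)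
  · exact (link_adj_iff _ _).2 (τ.adj_rootEnd hK i)
  · exact fun h => h02 (congrArg Subtype.val h)
  · exact fun h => h13 (congrArg Subtype.val h)

open Classical in
theorem rankTwoCount_cast (hK : K.IsMoebiusKantor) (τ : K.LargeTriangle f) :
    (τ.rankTwoCount : ZMod 2) =
      ∑ i, if K.dartGraph.IsFullPair (τ.rootStart i) (τ.rootEnd i) then 1 else 0 := by
  simp only [rankTwoCount, τ.rootRank_eq_two_iff hK]
  rw [Set.ncard_eq_toFinset_card', Set.toFinset_ofPred, Finset.card_filter]
  push_cast
  rfl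

/-- The root at the corner `i` ends in the triangles on the sides `i + 2` and `i`, so each side
influences exactly two corners. By `flip`, a new triangle on a side changes both of their ranks. -/
theorem rankTwoCount_cast_eq (hK : K.IsMoebiusKantor) (τ τ' : K.LargeTriangle f) :
    (τ.rankTwoCount : ZMod 2) = τ'.rankTwoCount := by
  classical
  rw [rankTwoCount_cast hK, rankTwoCount_cast hK]
  have key : ∀ i, (K.dartGraph.IsFullPair (τ.rootStart i) (τ.rootEnd i) ↔
      K.dartGraph.IsFullPair (τ'.rootStart i) (τ'.rootEnd i)) ↔
      ((τ.face (i + 2), τ.side (i + 2)) = (τ'.face (i + 2), τ'.side (i + 2)) ↔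
        (τ.face i, τ.side i) = (τ'.face i, τ'.side i)) := by
    intro i
    rw [hK.flip (τ.adj_rootStart hK i) (τ'.adj_rootStart hK i) (adj_mid hK f i)
      (τ.adj_rootEnd hK i) (τ'.adj_rootEnd hK i) (τ.rootStart_ne hK i) (τ'.rootStart_ne hK i)
      (τ.ne_rootEnd hK i) (τ'.ne_rootEnd hK i), rootEnd, rootEnd, rootStart, rootStart,
      hK.otherDart_inj (τ.glued i) (τ'.glued i),
      hK.otherDart_inj (τ.glued_rev (i + 2)) (τ'.glued_rev (i + 2))]
  have k0 := key 0
  have k1 := key 1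
  have k2 := key 2
  simp only [zero_add, show (1 : Fin 3) + 2 = 0 from rfl, show (2 : Fin 3) + 2 = 1 from rfl]
    at k0 k1 k2
  rw [Fin.sum_univ_three, Fin.sum_univ_three]
  exact sum_boole_eq_of_flip k0 k1 k2

end LargeTriangle

-- The existential quantifier in `parity` is harmless: by independence any one large triangle
-- computes it.
open Classical in
theorem parity_eq_sum (hK : K.IsMoebiusKantor) {f : K.F} (τ : K.LargeTriangle f) :
    K.parity f =
      ∑ i, if K.dartGraph.IsFullPair (τ.rootStart i) (τ.rootEnd i) then 1 else 0 := by
  rw [← τ.rankTwoCount_cast hK, parity]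
  have hodd : ∀ τ' : K.LargeTriangle f, Odd τ'.rankTwoCount ↔ (τ.rankTwoCount : ZMod 2) = 1 := by
    intro τ'
    rw [τ.rankTwoCount_cast_eq hK τ', ZMod.natCast_eq_one_iff_odd]
  split_ifs with h
  · obtain ⟨τ', h⟩ := h
    exact ((hodd τ').1 h).symm
  · have h1 : ¬ (τ.rankTwoCount : ZMod 2) = 1 := fun h1 => h ⟨τ, (hodd τ).2 h1⟩
    generalize (τ.rankTwoCount : ZMod 2) = z at h1
    revert z
    decide

end TriangleComplex

/-! ### Points of the standard triangle -/

theorem isSidePoint_iff {i : Fin 3} {t : ℝ} {a : stdSimplex ℝ (Fin 3)} :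
    IsSidePoint i t a ↔ a.1 i = 1 - t ∧ a.1 (i + 1) = t := by
  refine ⟨fun h => ⟨h.1, h.2.1⟩, fun h => ⟨h.1, h.2, ?_⟩⟩
  have h3 := a.2.2
  have : ∑ k, a.1 k = a.1 i + a.1 (i + 1) + a.1 (i + 2) := by
    rw [Fin.sum_univ_three]
    fin_cases i <;> simp <;> ring
  linarith [h.1, h.2]

theorem coord_eq_zero {i j k : Fin 3} {t : ℝ} {a : stdSimplex ℝ (Fin 3)} (hij : i ≠ j)
    (hik : k ≠ i) (hjk : k ≠ j) (hi : a.1 i = 1 - t) (hj : a.1 j = t) : a.1 k = 0 := by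
  have h3 := a.2.2
  have : ∑ l, a.1 l = a.1 i + a.1 j + a.1 k := by
    rw [Fin.sum_univ_three]
    revert i j k
    intro i j k
    fin_cases i <;> fin_cases j <;> fin_cases k <;> simp <;> intros <;> ring
  linarith

theorem exists_edgePoint {i j : Fin 3} (hij : i ≠ j) {t : ℝ} (h0 : 0 ≤ t) (h1 : t ≤ 1) :
    ∃ a : stdSimplex ℝ (Fin 3), a.1 i = 1 - t ∧ a.1 j = t := by
  refine ⟨⟨fun k => if k = i then 1 - t else if k = j then t else 0, fun k => ?_, ?_⟩, ?_, ?_⟩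
  · dsimp only
    split_ifs <;> linarith
  · rw [Fin.sum_univ_three]
    revert i j
    intro i j
    fin_cases i <;> fin_cases j <;> simp
  · simp
  · simp [hij.symm]

theorem triangleDist_sq (a b : stdSimplex ℝ (Fin 3)) :
    triangleDist a b ^ 2 = (∑ i, (a.1 i - b.1 i) ^ 2) / 2 :=
  Real.sq_sqrt (by positivity)

/-- Two points of the triangle at distance at least 1 are distinct corners. -/
theorem eq_corner_of_one_le_triangleDist {a b : stdSimplex ℝ (Fin 3)}
    (h : 1 ≤ triangleDist a b) : ∃ i, a.1 i = 1 ∧ b.1 i = 0 := by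
  have h2 : 1 ≤ triangleDist a b ^ 2 := by nlinarith
  rw [triangleDist_sq, Fin.sum_univ_three] at h2
  have ha := a.2.2
  have hb := b.2.2
  rw [Fin.sum_univ_three] at ha hb
  change a.1 0 + a.1 1 + a.1 2 = 1 at ha
  change b.1 0 + b.1 1 + b.1 2 = 1 at hb
  have a0 : 0 ≤ a.1 0 := a.2.1 0
  have a1 : 0 ≤ a.1 1 := a.2.1 1
  have a2 : 0 ≤ a.1 2 := a.2.1 2
  have b0 : 0 ≤ b.1 0 := b.2.1 0
  have b1 : 0 ≤ b.1 1 := b.2.1 1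
  have b2 : 0 ≤ b.1 2 := b.2.1 2
  -- Since the coordinates sum to 1, the squared distance is `1 - ∑ a_i a_j - ∑ b_i b_j - ∑ a_i
  -- b_i`, the first two sums over `i < j`. All the subtracted terms are nonnegative, so they
  -- vanish.
  have hx : a.1 0 * a.1 1 = 0 ∧ a.1 0 * a.1 2 = 0 ∧ a.1 1 * a.1 2 = 0 := by
    have := mul_nonneg a0 a1
    have := mul_nonneg a0 a2
    have := mul_nonneg a1 a2
    have := mul_nonneg b0 b1
    have := mul_nonneg b0 b2
    have := mul_nonneg b1 b2
    have := mul_nonneg a0 b0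
    have := mul_nonneg a1 b1
    have := mul_nonneg a2 b2
    have := congrArg (· ^ 2) ha
    have := congrArg (· ^ 2) hb
    refine ⟨?_, ?_, ?_⟩ <;> nlinarith
  have corner : ∀ {x₀ x₁ x₂ y₀ y₁ y₂ : ℝ}, x₀ + x₁ + x₂ = 1 → x₁ = 0 → x₂ = 0 →
      y₀ + y₁ + y₂ = 1 → 0 ≤ y₀ → 0 ≤ y₁ → 0 ≤ y₂ →
      1 ≤ ((x₀ - y₀) ^ 2 + (x₁ - y₁) ^ 2 + (x₂ - y₂) ^ 2) / 2 → x₀ = 1 ∧ y₀ = 0 := by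
    intro x₀ x₁ x₂ y₀ y₁ y₂ hx h1 h2 hy p0 p1 p2 h
    have hx0 : x₀ = 1 := by linarith
    subst hx0 h1 h2
    refine ⟨rfl, le_antisymm ?_ p0⟩
    nlinarith [mul_nonneg p1 p2, mul_nonneg p0 p1, mul_nonneg p0 p2]
  by_cases h0 : a.1 0 = 0
  · by_cases h1 : a.1 1 = 0
    · exact ⟨2, corner (by linarith) h0 h1 (y₁ := b.1 0) (y₂ := b.1 1) (by linarith) b2 b0 b1
        (by linarith)⟩
    · have h3 := (mul_eq_zero.1 hx.2.2).resolve_left h1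
      exact ⟨1, corner (by linarith) h0 h3 (y₁ := b.1 0) (y₂ := b.1 2) (by linarith) b1 b0 b2
        (by linarith)⟩
  · exact ⟨0, corner ha ((mul_eq_zero.1 hx.1).resolve_left h0)
      ((mul_eq_zero.1 hx.2.1).resolve_left h0) hb b0 b1 b2 h2⟩

theorem coord_eq_zero_of_corner {i k : Fin 3} {c : stdSimplex ℝ (Fin 3)} (hc : c.1 i = 1)
    (hk : k ≠ i) : c.1 k = 0 := by
  have h : c.1 i + c.1 k ≤ ∑ l, c.1 l := by
    rw [← Finset.sum_pair hk.symm]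
    exact Finset.sum_le_sum_of_subset_of_nonneg (Finset.subset_univ _) fun l _ _ => c.2.1 l
  have h1 : ∑ l, c.1 l = 1 := c.2.2
  have h2 : 0 ≤ c.1 k := c.2.1 k
  linarith

theorem triangleDist_corner_sq {i : Fin 3} {c : stdSimplex ℝ (Fin 3)} (hc : c.1 i = 1)
    (a : stdSimplex ℝ (Fin 3)) :
    triangleDist a c ^ 2 = ((∑ k, a.1 k ^ 2) - 2 * a.1 i + 1) / 2 := by
  have h : ∀ k, (a.1 k - c.1 k) ^ 2 = a.1 k ^ 2 + if k = i then 1 - 2 * a.1 i else 0 := by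
    intro k
    split_ifs with hk
    · rw [hk, hc]
      ring
    · rw [coord_eq_zero_of_corner hc hk]
      ring
  rw [triangleDist_sq, Finset.sum_congr rfl fun k _ => h k, Finset.sum_add_distrib,
    Finset.sum_ite_eq' Finset.univ i]
  simp
  ring

/-- A non-contracting self-map of the triangle permutes the coordinates. -/
theorem exists_perm_of_le_triangleDist (g : stdSimplex ℝ (Fin 3) → stdSimplex ℝ (Fin 3))
    (hg : ∀ a b, triangleDist a b ≤ triangleDist (g a) (g b)) :
    ∃ σ : Equiv.Perm (Fin 3), ∀ a i, (g a).1 (σ i) = a.1 i := by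
  have hg2 : ∀ a b, triangleDist a b ^ 2 ≤ triangleDist (g a) (g b) ^ 2 := fun a b =>
    pow_le_pow_left₀ (Real.sqrt_nonneg _) (hg a b) 2
  have hC : ∀ i : Fin 3, ∃ a : stdSimplex ℝ (Fin 3), a.1 i = 1 := fun i => by
    obtain ⟨a, ha, -⟩ := exists_edgePoint (i := i) (j := i + 1) (by simp) le_rfl zero_le_one
    exact ⟨a, by simpa using ha⟩
  choose C hC using hC
  have hd : ∀ i j, i ≠ j → 1 ≤ triangleDist (g (C i)) (g (C j)) := by
    intro i j hij
    refine le_trans ?_ (hg _ _)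
    have h1 := triangleDist_corner_sq (hC j) (C i)
    rw [coord_eq_zero_of_corner (hC i) hij.symm, Finset.sum_eq_single i
      (fun k _ hk => by rw [coord_eq_zero_of_corner (hC i) hk]; norm_num) (by simp), hC i] at h1
    have h0 : 0 ≤ triangleDist (C i) (C j) := Real.sqrt_nonneg _
    nlinarith
  have hσ : ∀ i, ∃ k, (g (C i)).1 k = 1 := fun i => by
    obtain ⟨k, hk, -⟩ := eq_corner_of_one_le_triangleDist (hd i (i + 1) (by simp))
    exact ⟨k, hk⟩
  choose σ hσ using hσ
  have hinj : Function.Injective σ := by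
    intro i j hij
    by_contra hne
    obtain ⟨k, hk, hk'⟩ := eq_corner_of_one_le_triangleDist (hd i j hne)
    have : k = σ i := by
      by_contra hki
      rw [coord_eq_zero_of_corner (hσ i) hki] at hk
      norm_num at hk
    rw [this, hij, hσ j] at hk'
    norm_num at hk'
  refine ⟨Equiv.ofBijective σ (Finite.injective_iff_bijective.1 hinj), fun a => ?_⟩
  simp only [Equiv.ofBijective_apply]
  have s1 : ∑ i, (g a).1 (σ i) = 1 :=
    ((Equiv.ofBijective σ (Finite.injective_iff_bijective.1 hinj)).sum_comp
      fun k => (g a).1 k).trans (g a).2.2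
  have s2 : ∑ i, (g a).1 (σ i) ^ 2 = ∑ k, (g a).1 k ^ 2 :=
    (Equiv.ofBijective σ (Finite.injective_iff_bijective.1 hinj)).sum_comp fun k => (g a).1 k ^ 2
  -- This is the distance inequality between `a` and the corner `i`, whose image is the corner `σ
  -- i`.
  have key : ∀ i, (∑ k, a.1 k ^ 2) - 2 * a.1 i ≤
      (∑ k, (g a).1 (σ k) ^ 2) - 2 * (g a).1 (σ i) := by
    intro i
    have := hg2 a (C i)
    rw [triangleDist_corner_sq (hC i), triangleDist_corner_sq (hσ i), ← s2] at this
    linarith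
  have hpos : ∀ i, 0 ≤ (g a).1 (σ i) := fun i => (g a).2.1 _
  -- Write `x` for `a` and `y` for the permuted image. Weighting the inequalities by the `y i`,
  -- which sum to 1, and adding gives `0 ≤ -|x - y|²`.
  have key' : ∀ i, 0 ≤ (g a).1 (σ i) * ((∑ k, (g a).1 (σ k) ^ 2) - 2 * (g a).1 (σ i) -
      ((∑ k, a.1 k ^ 2) - 2 * a.1 i)) := fun i => mul_nonneg (hpos i) (by linarith [key i])
  have hsum : ∑ i, ((g a).1 (σ i) - a.1 i) ^ 2 ≤ 0 := by
    have k0 := key' 0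
    have k1 := key' 1
    have k2 := key' 2
    simp only [Fin.sum_univ_three] at k0 k1 k2 s1 ⊢
    have s1' : (g a).1 (σ 2) = 1 - (g a).1 (σ 0) - (g a).1 (σ 1) := by linarith
    have := add_nonneg (add_nonneg k0 k1) k2
    rw [s1'] at this ⊢
    linarith
  intro i
  have h1 : ((g a).1 (σ i) - a.1 i) ^ 2 ≤ 0 :=
    (Finset.single_le_sum (f := fun i => ((g a).1 (σ i) - a.1 i) ^ 2)
      (fun _ _ => sq_nonneg _) (Finset.mem_univ i)).trans hsum
  have h2 : (g a).1 (σ i) - a.1 i = 0 := pow_eq_zero_iff two_ne_zero |>.1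
    (le_antisymm h1 (sq_nonneg _))
  linarith

namespace TriangleComplex

variable {K : TriangleComplex.{u}}

/-! ### Points on edges in the realization -/

theorem Glue.symm {x y : K.F × stdSimplex ℝ (Fin 3)} (h : K.Glue x y) : K.Glue y x := by
  cases h with
  | side f g i j t a b h ha hb => exact .side g f j i t b a h.symm hb ha
  | side_rev f g i j t a b h ha hb =>
    exact .side_rev g f j i (1 - t) b a (by rw [h, K.rev_rev]) hb (by simpa using ha)
  | corner f g i j a b h ha hb => exact .corner g f j i b a h.symm hb ha

/-- The point `x.2` of the face `x.1` lies on the oriented edge `d`, at distance `t` from the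
origin. -/
def OnDart (K : TriangleComplex.{u}) (d : K.D) (t : ℝ) (x : K.F × stdSimplex ℝ (Fin 3)) : Prop :=
  ∃ i j, i ≠ j ∧ K.dart x.1 i j = d ∧ x.2.1 i = 1 - t ∧ x.2.1 j = t

/-- A point interior to an edge is not a corner and lies on only one side of its face, so gluing
preserves the edge and the position on it. -/
theorem OnDart.of_glue {d : K.D} {t : ℝ} (h0 : 0 < t) (h1 : t < 1)
    {x y : K.F × stdSimplex ℝ (Fin 3)} (h : K.Glue x y) (hx : K.OnDart d t x) :
    K.OnDart d t y := by
  obtain ⟨c, c', hc, hd, hi, hj⟩ := hx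
  have side_cases : ∀ {i : Fin 3} {s : ℝ} {a : stdSimplex ℝ (Fin 3)}, IsSidePoint i s a →
      a.1 c = 1 - t → a.1 c' = t → (c = i ∧ c' = i + 1 ∧ t = s) ∨
        (c = i + 1 ∧ c' = i ∧ t = 1 - s) := by
    rintro i s a ⟨ha, hb, hc0⟩ hi hj
    have e1 : c ≠ i + 2 := by
      rintro rfl
      linarith
    have e2 : c' ≠ i + 2 := by
      rintro rfl
      linarith
    have e3 : ∀ {c c' i : Fin 3}, c ≠ c' → c ≠ i + 2 → c' ≠ i + 2 →
      (c = i ∧ c' = i + 1) ∨ (c = i + 1 ∧ c' = i) := by decide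
    rcases e3 hc e1 e2 with ⟨rfl, rfl⟩ | ⟨rfl, rfl⟩
    · exact Or.inl ⟨rfl, rfl, by linarith⟩
    · exact Or.inr ⟨rfl, rfl, by linarith⟩
  cases h with
  | side f g i j s a b h ha hb =>
    rcases side_cases ha hi hj with ⟨rfl, rfl, rfl⟩ | ⟨rfl, rfl, rfl⟩
    · exact ⟨j, j + 1, by simp, by rw [← hd, dart_add_one, dart_add_one, h], hb.1, hb.2.1⟩
    · exact ⟨j + 1, j, by simp, by rw [← hd, add_one_dart, add_one_dart, h],
        by rw [hb.2.1]; ring, hb.1⟩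
  | side_rev f g i j s a b h ha hb =>
    rcases side_cases ha hi hj with ⟨rfl, rfl, rfl⟩ | ⟨rfl, rfl, rfl⟩
    · exact ⟨j + 1, j, by simp, by rw [← hd, dart_add_one, add_one_dart, h], hb.2.1,
        by rw [hb.1]; ring⟩
    · exact ⟨j, j + 1, by simp, by rw [← hd, dart_add_one, add_one_dart, h, K.rev_rev], hb.1,
        hb.2.1⟩
  | corner f g i j a b h ha hb =>
    dsimp only at hi hj
    have e1 : i ≠ c := by
      rintro rfl
      linarith
    have e2 : i ≠ c' := by
      rintro rfl
      linarith
    have := coord_eq_zero hc e1 e2 hi hj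
    linarith

/-- Equality in the realization is a chain of gluings; an invariant predicate descends to the
quotient. -/
theorem onDart_of_point_eq {d : K.D} {t : ℝ} (h0 : 0 < t) (h1 : t < 1) {f g : K.F}
    {a b : stdSimplex ℝ (Fin 3)} (h : K.point f a = K.point g b) (hf : K.OnDart d t (f, a)) :
    K.OnDart d t (g, b) := by
  let P : K.Realization → Prop := Quot.lift (K.OnDart d t) fun _ _ hxy =>
    propext ⟨OnDart.of_glue h0 h1 hxy, OnDart.of_glue h0 h1 hxy.symm⟩
  have : P (K.point f a) = P (K.point g b) := congrArg P h
  exact this.mp hf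

/-- The parameter `1 / 3` is deliberately not `1 / 2`: the midpoint would not remember the
orientation of the edge. -/
theorem dart_eq_of_point_eq {f g : K.F} {a b : stdSimplex ℝ (Fin 3)} {i j i' j' : Fin 3}
    (hij : i ≠ j) (hij' : i' ≠ j') (h : K.point f a = K.point g b) (hi : a.1 i = 1 - 1 / 3)
    (hj : a.1 j = 1 / 3) (hi' : b.1 i' = 1 - 1 / 3) (hj' : b.1 j' = 1 / 3) :
    K.dart f i j = K.dart g i' j' := by
  obtain ⟨c, c', hc, hd, h1, h2⟩ := onDart_of_point_eq (by norm_num) (by norm_num) h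
    (⟨i, j, hij, rfl, hi, hj⟩ : K.OnDart (K.dart f i j) (1 / 3) (f, a))
  dsimp only at hd h1 h2
  have e0 : ∀ k, k ≠ i' → k ≠ j' → b.1 k = 0 := fun k h h' => coord_eq_zero hij' h h' hi' hj'
  have e1 : c = i' := by
    by_contra hne
    by_cases hcj : c = j'
    · rw [hcj, hj'] at h1
      norm_num at h1
    · rw [e0 c hne hcj] at h1
      norm_num at h1
  have e2 : c' = j' := by
    by_contra hne
    rw [e0 c' (e1 ▸ hc.symm) hne] at h2
    norm_num at h2
  rw [← hd, e1, e2]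

theorem point_eq_of_dart_eq {f g : K.F} {a b : stdSimplex ℝ (Fin 3)} {i j i' j' : Fin 3} {t : ℝ}
    (hij : i ≠ j) (hij' : i' ≠ j') (h : K.dart f i j = K.dart g i' j') (hi : a.1 i = 1 - t)
    (hj : a.1 j = t) (hi' : b.1 i' = 1 - t) (hj' : b.1 j' = t) :
    K.point f a = K.point g b := by
  apply Quot.sound
  have e : ∀ {i j : Fin 3}, i ≠ j → j = i + 1 ∨ i = j + 1 := by decide
  rcases e hij with rfl | rfl <;> rcases e hij' with rfl | rfl
  · rw [dart_add_one, dart_add_one] at h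
    exact .side f g i i' t a b h (isSidePoint_iff.2 ⟨hi, hj⟩) (isSidePoint_iff.2 ⟨hi', hj'⟩)
  · rw [dart_add_one, add_one_dart] at h
    exact .side_rev f g i j' t a b h (isSidePoint_iff.2 ⟨hi, hj⟩)
      (isSidePoint_iff.2 ⟨by rw [hj']; ring, hi'⟩)
  · rw [dart_add_one, add_one_dart] at h
    refine .side_rev f g j i' (1 - t) a b (by rw [← h, K.rev_rev])
      (isSidePoint_iff.2 ⟨by rw [hj]; ring, hi⟩)
      (isSidePoint_iff.2 ⟨by rw [hi']; ring, by rw [hj']; ring⟩)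
  · rw [add_one_dart, add_one_dart] at h
    have h' := congrArg K.rev h
    rw [K.rev_rev, K.rev_rev] at h'
    exact .side f g j j' (1 - t) a b h' (isSidePoint_iff.2 ⟨by rw [hj]; ring, hi⟩)
      (isSidePoint_iff.2 ⟨by rw [hj']; ring, hi'⟩)

/-- Only this inequality between the two metrics is needed: it makes the map induced by an isometry
on a face non-contracting. -/
theorem intrinsicDist_point_le (f : K.F) (a b : stdSimplex ℝ (Fin 3)) :
    K.intrinsicDist (K.point f a) (K.point f b) ≤ ENNReal.ofReal (triangleDist a b) := by
  unfold intrinsicDist localDist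
  refine iInf_le_of_le 1 <| iInf_le_of_le ![K.point f a, K.point f b] <|
    iInf_le_of_le ⟨rfl, rfl⟩ ?_
  simp only [Finset.univ_unique, Finset.sum_singleton]
  exact iInf_le_of_le f <| iInf_le_of_le a <| iInf_le_of_le b <| iInf_le_of_le ⟨rfl, rfl⟩ le_rfl

theorem intrinsicDist_self (x : K.Realization) : K.intrinsicDist x x = 0 := by
  unfold intrinsicDist
  refine le_antisymm ?_ zero_le
  refine iInf_le_of_le 0 <| iInf_le_of_le (fun _ => x) <| iInf_le_of_le ⟨rfl, rfl⟩ ?_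
  simp

theorem IsIsometricEmbedding.injective {φ : EuclideanSpace ℝ (Fin 2) → K.Realization}
    (h : K.IsIsometricEmbedding φ) : Function.Injective φ := by
  intro x y hxy
  have := h x y
  rw [hxy, intrinsicDist_self] at this
  exact edist_eq_zero.1 this.symm

end TriangleComplex

/-! ### Corners of the faces of the tessellation -/

theorem latticePoint_injective {v w : ℤ × ℤ} (h : latticePoint v.1 v.2 = latticePoint w.1 w.2) :
    v = w := by
  obtain ⟨m, n⟩ := v
  obtain ⟨m', n'⟩ := w
  have h0 := congrArg (fun x : EuclideanSpace ℝ (Fin 2) => x 0) h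
  have h1 := congrArg (fun x : EuclideanSpace ℝ (Fin 2) => x 1) h
  simp only [latticePoint, PiLp.toLp_apply, Matrix.cons_val_zero, Matrix.cons_val_one] at h0 h1
  have hn : (n : ℝ) = n' := mul_right_cancel₀ (by positivity) h1
  rw [hn] at h0
  have hm : (m : ℝ) = m' := by linarith
  rw [Int.cast_inj.1 hn, Int.cast_inj.1 hm]

namespace TessFace

/-- The positions of the corners of the face `(0, 0, true)`. -/
def offset : Fin 3 → ℤ × ℤ := ![(0, 0), (1, 0), (0, 1)]

/-- The corners of a face, labelled in such a way that vertical angles have the same label. -/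
def corner : TessFace → Fin 3 → ℤ × ℤ
  | (m, n, true), i => (m, n) + offset i
  | (m, n, false), i => (m + 1, n + 1) - offset i

/-- The face on the other side of the edge opposite to a corner. -/
def neighbor : TessFace → Fin 3 → TessFace
  | (m, n, true), k => (m - (offset k).1, n - (offset k).2, false)
  | (m, n, false), k => (m + (offset k).1, n + (offset k).2, true)

/-- Adjacent faces point in opposite directions, so their two common corners exchange labels. -/
theorem corner_neighbor (T : TessFace) {i j k : Fin 3} (hij : i ≠ j) (hik : i ≠ k)
    (hjk : j ≠ k) : (T.neighbor k).corner i = T.corner j := by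
  obtain ⟨m, n, b⟩ := T
  have h : offset i + offset j + offset k = (1, 1) := by
    revert i j k
    decide
  obtain ⟨h1, h2⟩ := Prod.ext_iff.1 h
  simp only [Prod.fst_add, Prod.snd_add] at h1 h2
  cases b <;> ext <;> simp [corner, neighbor] <;> omega

theorem corner_neighbor_self_ne (T : TessFace) (k : Fin 3) :
    (T.neighbor k).corner k ≠ T.corner k := by
  obtain ⟨m, n, b⟩ := T
  have h : offset k + offset k + offset k ≠ (1, 1) := by
    revert k
    decide
  contrapose! h
  obtain ⟨h1, h2⟩ := Prod.ext_iff.1 h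
  cases b <;> simp [corner, neighbor] at h1 h2 <;> ext <;> simp <;> omega

/-- The point with given barycentric coordinates. -/
noncomputable def bary (T : TessFace) (a : stdSimplex ℝ (Fin 3)) : EuclideanSpace ℝ (Fin 2) :=
  ∑ i, a.1 i • latticePoint (T.corner i).1 (T.corner i).2

theorem latticePoint_corner_mem (T : TessFace) (i : Fin 3) :
    latticePoint (T.corner i).1 (T.corner i).2 ∈ T.vertices := by
  obtain ⟨m, n, b⟩ := T
  cases b <;> fin_cases i <;> simp [corner, offset, vertices]

theorem bary_mem_carrier (T : TessFace) (a : stdSimplex ℝ (Fin 3)) : T.bary a ∈ T.carrier :=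
  (convex_convexHull ℝ _).sum_mem (fun i _ => a.2.1 i) a.2.2
    fun i _ => subset_convexHull ℝ _ (T.latticePoint_corner_mem i)

theorem bary_eq_of_edge (T : TessFace) {i j : Fin 3} (hij : i ≠ j) {t : ℝ}
    {a : stdSimplex ℝ (Fin 3)} (hi : a.1 i = 1 - t) (hj : a.1 j = t) :
    T.bary a = (1 - t) • latticePoint (T.corner i).1 (T.corner i).2 +
      t • latticePoint (T.corner j).1 (T.corner j).2 := by
  rw [bary, ← Finset.sum_subset (Finset.subset_univ {i, j}), Finset.sum_pair hij, hi, hj]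
  intro k _ hk
  simp only [Finset.mem_insert, Finset.mem_singleton, not_or] at hk
  rw [coord_eq_zero hij hk.1 hk.2 hi hj, zero_smul]

theorem dist_bary (T : TessFace) (a b : stdSimplex ℝ (Fin 3)) :
    dist (T.bary a) (T.bary b) = triangleDist a b := by
  rw [EuclideanSpace.dist_eq, triangleDist]
  congr 1
  have ha : a.1 0 + a.1 1 + a.1 2 = 1 := by
    rw [← Fin.sum_univ_three]
    exact a.2.2
  have hb : b.1 0 + b.1 1 + b.1 2 = 1 := by
    rw [← Fin.sum_univ_three]
    exact b.2.2
  have ha0 : a.1 0 = 1 - a.1 1 - a.1 2 := by linarith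
  have hb0 : b.1 0 = 1 - b.1 1 - b.1 2 := by linarith
  have h3 : Real.sqrt 3 ^ 2 = 3 := Real.sq_sqrt (by norm_num)
  obtain ⟨m, n, c⟩ := T
  rw [Fin.sum_univ_two, Fin.sum_univ_three, Real.dist_eq, Real.dist_eq, sq_abs, sq_abs]
  cases c <;> simp [bary, Fin.sum_univ_three, corner, offset, latticePoint] <;>
    rw [ha0, hb0] <;> ring_nf <;> rw [h3] <;> ring

end TessFace

/-! ### A parity distribution which is not determined by vertex labels -/

/-- The parities determined by a labelling of the vertices of the tessellation by the three lines
of opposite angles; the label singles out the angles of rank less than 2. -/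
def parityOfLabels (s : ℤ × ℤ → Fin 3) (T : TessFace) : ZMod 2 :=
  ∑ i, if s (T.corner i) = i then 0 else 1

/-- Labellings of a finite window are fewer than its parity patterns, so the map between them cannot
be surjective. -/
theorem exists_ne_parityOfLabels :
    ∃ p : AbstractParityDistribution, ∀ s, p ≠ parityOfLabels s := by
  by_contra! h
  -- The 162 faces of a `9 × 9` rhombus have their corners among its 100 vertices; 9 is the smallest
  -- side length for which `3 ^ ((n + 1) ^ 2) < 2 ^ (2 * n ^ 2)`. Values of `E` outside the window
  -- are irrelevant.
  let E : (Fin 10 × Fin 10 → Fin 3) → ℤ × ℤ → Fin 3 := fun t v =>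
    t (Fin.ofNat 10 v.1.toNat, Fin.ofNat 10 v.2.toNat)
  let Q : (Fin 10 × Fin 10 → Fin 3) → (Fin 9 × Fin 9 × Bool → ZMod 2) := fun t x =>
    parityOfLabels (E t) (((x.1 : ℕ) : ℤ), ((x.2.1 : ℕ) : ℤ), x.2.2)
  have hQ : Function.Surjective Q := by
    intro q
    obtain ⟨s, hs⟩ := h fun T => q (Fin.ofNat 9 T.1.toNat, Fin.ofNat 9 T.2.1.toNat, T.2.2)
    refine ⟨fun x => s (((x.1 : ℕ) : ℤ), ((x.2 : ℕ) : ℤ)), ?_⟩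
    funext ⟨m, n, b⟩
    have hE : ∀ v : ℤ × ℤ, 0 ≤ v.1 → v.1 ≤ 9 → 0 ≤ v.2 → v.2 ≤ 9 →
        E (fun x => s (((x.1 : ℕ) : ℤ), ((x.2 : ℕ) : ℤ))) v = s v := by
      rintro ⟨x, y⟩ h1 h2 h3 h4
      simp only at h1 h2 h3 h4
      simp only [E, Fin.val_ofNat]
      congr 1
      ext <;> simp only <;> omega
    have hq := congrFun hs (((m : ℕ) : ℤ), ((n : ℕ) : ℤ), b)
    simp only [Int.toNat_natCast, Fin.ofNat_val_eq_self] at hq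
    rw [hq]
    simp only [Q, parityOfLabels]
    refine Finset.sum_congr rfl fun i _ => ?_
    have hm := m.2
    have hn := n.2
    rw [hE] <;> cases b <;> fin_cases i <;> simp [TessFace.corner, TessFace.offset] <;> omega
  have := Fintype.card_le_of_surjective Q hQ
  simp only [Fintype.card_pi, Finset.prod_const, Finset.card_univ, Fintype.card_prod,
    Fintype.card_fin, ZMod.card, Fintype.card_bool] at this
  norm_num at this

namespace TriangleComplex

variable {K : TriangleComplex.{u}}

/-! ### The faces of a flat -/

/-- Faces `F T` of `K` which are the images of the faces of the tessellation of the plane under an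
injective map that is affine on every face; `σ T` tells which corner goes where. -/
structure TessellatedPlane (K : TriangleComplex.{u}) where
  φ : EuclideanSpace ℝ (Fin 2) → K.Realization
  injective : Function.Injective φ
  F : TessFace → K.F
  σ : TessFace → Equiv.Perm (Fin 3)
  point_eq : ∀ T a b, (∀ i, b.1 (σ T i) = a.1 i) → K.point (F T) b = φ (TessFace.bary T a)

/-- The definition only fixes the image of each face as a set; non-contraction forces the
parametrization to be the affine one, up to a permutation of corners. -/
theorem IsParityDistributionOf.exists_tessellatedPlane {p : AbstractParityDistribution}
    {P : Set K.Realization} (h : K.IsParityDistributionOf p P) :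
    ∃ Q : K.TessellatedPlane, ∀ T, p T = K.parity (Q.F T) := by
  obtain ⟨φ, hφ, -, hT⟩ := h
  choose F hF hp using hT
  have key : ∀ T, ∃ σ : Equiv.Perm (Fin 3), ∀ a b : stdSimplex ℝ (Fin 3),
      (∀ i, b.1 (σ i) = a.1 i) → K.point (F T) b = φ (TessFace.bary T a) := by
    intro T
    have hg : ∀ a, ∃ b, K.point (F T) b = φ (T.bary a) := fun a => by
      have : φ (T.bary a) ∈ K.faceSet (F T) := hF T ▸ ⟨_, T.bary_mem_carrier a, rfl⟩
      exact this
    choose g hg using hg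
    obtain ⟨σ, hσ⟩ := exists_perm_of_le_triangleDist g fun a b => by
      have h1 := hφ (T.bary a) (T.bary b)
      rw [← hg, ← hg, edist_dist, T.dist_bary] at h1
      have h2 := intrinsicDist_point_le (F T) (g a) (g b)
      rw [h1] at h2
      exact (ENNReal.ofReal_le_ofReal_iff (Real.sqrt_nonneg _)).1 h2
    refine ⟨σ, fun a b hb => ?_⟩
    have : b = g a := by
      ext k
      have := (hb (σ.symm k)).trans (hσ a (σ.symm k)).symm
      rwa [Equiv.apply_symm_apply] at this
    rw [this, hg]
  choose σ hσ using key
  exact ⟨⟨φ, hφ.injective, F, σ, hσ⟩, hp⟩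

theorem exists_permuted (σ : Equiv.Perm (Fin 3)) (a : stdSimplex ℝ (Fin 3)) :
    ∃ b : stdSimplex ℝ (Fin 3), ∀ i, b.1 (σ i) = a.1 i :=
  ⟨⟨fun k => a.1 (σ.symm k), fun _ => a.2.1 _, (σ.symm.sum_comp a.1).trans a.2.2⟩,
    fun i => congrArg a.1 (σ.symm_apply_apply i)⟩

theorem bd_eq_or_of_dart (f g : K.F) {i j i' j' s s' : Fin 3} (hij : i ≠ j) (hi : i ≠ s + 2)
    (hj : j ≠ s + 2) (hij' : i' ≠ j') (hi' : i' ≠ s' + 2) (hj' : j' ≠ s' + 2)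
    (h : K.dart f i j = K.dart g i' j') :
    K.bd f s = K.bd g s' ∨ K.bd f s = K.rev (K.bd g s') := by
  have e : ∀ {i j s : Fin 3}, i ≠ j → i ≠ s + 2 → j ≠ s + 2 →
      (i = s ∧ j = s + 1) ∨ (i = s + 1 ∧ j = s) := by decide
  rcases e hij hi hj with ⟨rfl, rfl⟩ | ⟨rfl, rfl⟩ <;>
    rcases e hij' hi' hj' with ⟨rfl, rfl⟩ | ⟨rfl, rfl⟩ <;>
    simp only [dart_add_one, add_one_dart] at h
  · exact Or.inl h
  · exact Or.inr h
  · exact Or.inr (by rw [← h, K.rev_rev])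
  · exact Or.inl (by rw [← K.rev_rev (K.bd f _), h, K.rev_rev])

namespace TessellatedPlane

variable (Q : K.TessellatedPlane)

/-- The image of the oriented edge of `T` from the corner `i` to the corner `j`. -/
def edge (T : TessFace) (i j : Fin 3) : K.D := K.dart (Q.F T) (Q.σ T i) (Q.σ T j)

/-- Injectivity separates distinct oriented edges, by comparing the endpoints `t = 0` and `t = 1`.
Conversely the common point at `t = 1 / 3` identifies the edge and its orientation. -/
theorem edge_eq_iff {T T' : TessFace} {i j i' j' : Fin 3} (hij : i ≠ j) (hij' : i' ≠ j') :
    Q.edge T i j = Q.edge T' i' j' ↔ T.corner i = T'.corner i' ∧ T.corner j = T'.corner j' := by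
  constructor
  · intro h
    have key : ∀ t : ℝ, 0 ≤ t → t ≤ 1 →
        (1 - t) • latticePoint (T.corner i).1 (T.corner i).2 +
          t • latticePoint (T.corner j).1 (T.corner j).2 =
        (1 - t) • latticePoint (T'.corner i').1 (T'.corner i').2 +
          t • latticePoint (T'.corner j').1 (T'.corner j').2 := by
      intro t h0 h1
      obtain ⟨a, hai, haj⟩ := exists_edgePoint hij h0 h1
      obtain ⟨a', hai', haj'⟩ := exists_edgePoint hij' h0 h1
      obtain ⟨b, hb⟩ := exists_permuted (Q.σ T) a
      obtain ⟨b', hb'⟩ := exists_permuted (Q.σ T') a'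
      have := point_eq_of_dart_eq (by simpa) (by simpa) h ((hb i).trans hai) ((hb j).trans haj)
        ((hb' i').trans hai') ((hb' j').trans haj')
      rw [Q.point_eq T a b hb, Q.point_eq T' a' b' hb'] at this
      rw [← T.bary_eq_of_edge hij hai haj, ← T'.bary_eq_of_edge hij' hai' haj']
      exact Q.injective this
    exact ⟨latticePoint_injective (by simpa using key 0 le_rfl zero_le_one),
      latticePoint_injective (by simpa using key 1 zero_le_one le_rfl)⟩
  · rintro ⟨hi, hj⟩
    obtain ⟨a, hai, haj⟩ := exists_edgePoint hij (t := 1 / 3) (by norm_num) (by norm_num)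
    obtain ⟨a', hai', haj'⟩ := exists_edgePoint hij' (t := 1 / 3) (by norm_num) (by norm_num)
    obtain ⟨b, hb⟩ := exists_permuted (Q.σ T) a
    obtain ⟨b', hb'⟩ := exists_permuted (Q.σ T') a'
    refine dart_eq_of_point_eq (by simpa) (by simpa) (a := b) (b := b') ?_ ((hb i).trans hai)
      ((hb j).trans haj) ((hb' i').trans hai') ((hb' j').trans haj')
    rw [Q.point_eq T a b hb, Q.point_eq T' a' b' hb', T.bary_eq_of_edge hij hai haj,
      T'.bary_eq_of_edge hij' hai' haj', hi, hj]

theorem edge_neighbor (T : TessFace) {i j k : Fin 3} (hij : i ≠ j) (hik : i ≠ k) (hjk : j ≠ k) :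
    Q.edge (T.neighbor k) j i = Q.edge T i j :=
  (Q.edge_eq_iff hij.symm hij).2
    ⟨T.corner_neighbor hij.symm hjk hik, T.corner_neighbor hij hik hjk⟩

/-- The large triangle in the flat around the image of a face. -/
def largeTriangle (T : TessFace) : K.LargeTriangle (Q.F T) where
  -- The side `c` is opposite to the corner `c + 2`, the image of the corner `k = σ⁻¹ (c + 2)` of
  -- `T`. In the neighbour across from `k`, the side opposite to the image of its apex `k` has index
  -- one more than that image, as `1 + 2 = 0` in `Fin 3`.
  face c := Q.F (T.neighbor ((Q.σ T).symm (c + 2)))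
  side c := Q.σ (T.neighbor ((Q.σ T).symm (c + 2))) ((Q.σ T).symm (c + 2)) + 1
  ne c h := by
    obtain ⟨k, hk⟩ := (Q.σ T).surjective (c + 2)
    rw [← hk, Equiv.symm_apply_apply, Prod.mk.injEq] at h
    obtain ⟨h1, h2⟩ := h
    have hσ : Q.σ (T.neighbor k) k = Q.σ T k := by
      rw [hk, ← h2, add_assoc]
      exact (add_zero _).symm
    obtain ⟨i, hi⟩ := (Q.σ T).surjective c
    obtain ⟨j, hj⟩ := (Q.σ (T.neighbor k)).surjective c
    have hki : k ≠ i := by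
      rintro rfl
      rw [hi] at hk
      simp at hk
    have hkj : k ≠ j := by
      rintro rfl
      rw [hj, hk] at hσ
      simp at hσ
    -- If face and side agreed, an edge issuing from the apex of the neighbour would coincide with
    -- one issuing from the corner `k` of `T`, but these are distinct lattice points.
    have : Q.edge (T.neighbor k) k j = Q.edge T k i := by
      rw [edge, edge, h1, hσ, hj, hi]
    exact T.corner_neighbor_self_ne k ((Q.edge_eq_iff hkj hki).1 this).1
  glued c := by
    obtain ⟨i, hi⟩ := (Q.σ T).surjective c
    obtain ⟨j, hj⟩ := (Q.σ T).surjective (c + 1)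
    obtain ⟨k, hk⟩ := (Q.σ T).surjective (c + 2)
    have hij : i ≠ j := by
      rintro rfl
      simp [hi] at hj
    have hik : i ≠ k := by
      rintro rfl
      simp [hi] at hk
    have hjk : j ≠ k := by
      rintro rfl
      simp [hj] at hk
    have hs : Q.σ (T.neighbor k) k + 1 + 2 = Q.σ (T.neighbor k) k := by
      rw [add_assoc]
      exact add_zero _
    rw [← hk, Equiv.symm_apply_apply]
    refine bd_eq_or_of_dart _ _ ?_ ?_ ?_ ?_ ?_ ?_ (Q.edge_neighbor T hij hik hjk)
    · simpa using hij.symm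
    · rw [hs]
      simpa using hjk
    · rw [hs]
      simpa using hik
    · simpa using hij
    · rw [← hk]
      simpa using hik
    · rw [← hk]
      simpa using hjk

theorem otherDart_neighbor (T : TessFace) {i j k : Fin 3} (hij : i ≠ j) (hik : i ≠ k)
    (hjk : j ≠ k) (c : Fin 3) (hc : (Q.σ T).symm (c + 2) = k) :
    K.otherDart ((Q.largeTriangle T).face c) ((Q.largeTriangle T).side c) (Q.edge T i j) =
      Q.edge (T.neighbor k) j k := by
  rw [← Q.edge_neighbor T hij hik hjk]
  simp only [largeTriangle, hc]
  refine otherDart_dart _ (by simpa using hij.symm) (by simpa) (by simpa) ?_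
  rw [add_assoc]
  exact (add_zero _).symm

/-- The order of `j` and `k` follows the cyclic order of the image face, and `σ T` may reverse
orientation, so it is not determined by `i`. -/
theorem root_ends (T : TessFace) (i : Fin 3) : ∃ j k, i ≠ j ∧ i ≠ k ∧ j ≠ k ∧
    (Q.largeTriangle T).rootStart (Q.σ T i) = Q.edge (T.neighbor j) k j ∧
    (Q.largeTriangle T).rootEnd (Q.σ T i) = Q.edge (T.neighbor k) j k := by
  obtain ⟨j, hj⟩ := (Q.σ T).surjective (Q.σ T i + 1)
  obtain ⟨k, hk⟩ := (Q.σ T).surjective (Q.σ T i + 2)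
  have hij : i ≠ j := by
    rintro rfl
    simp at hj
  have hik : i ≠ k := by
    rintro rfl
    simp at hk
  have hjk : j ≠ k := by
    rintro rfl
    simp [hj] at hk
  refine ⟨j, k, hij, hik, hjk, ?_, ?_⟩
  · rw [← Q.otherDart_neighbor T hik hij hjk.symm (Q.σ T i + 2)]
    · rw [LargeTriangle.rootStart, edge, hk, dart_add_two]
    · rw [Equiv.symm_apply_eq, hj, add_assoc]
      rfl
  · rw [← Q.otherDart_neighbor T hij hik hjk (Q.σ T i)]
    · rw [LargeTriangle.rootEnd, edge, hj, dart_add_one]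
    · rw [Equiv.symm_apply_eq, hk]

/-! ### The hexagon around a vertex of a flat -/

/-- The image of the oriented edge from `v` to `v + offset j - offset i`. -/
def ray (v : ℤ × ℤ) (i j : Fin 3) : K.D :=
  Q.edge (v.1 - (TessFace.offset i).1, v.2 - (TessFace.offset i).2, true) i j

/-- This expresses the ends of the root as rays at the vertex. For downward faces the rays are
reversed (`ray_corner_down`), so vertical angles share their pair of ends. -/
theorem ray_corner_up (m n : ℤ) {i j k : Fin 3} (hij : i ≠ j) (hik : i ≠ k) (hjk : j ≠ k) :
    Q.ray (TessFace.corner (m, n, true) i) k j =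
      Q.edge (TessFace.neighbor (m, n, true) k) j k := by
  rw [ray, edge_eq_iff Q hjk.symm hjk, TessFace.corner_neighbor _ hij.symm hjk hik]
  have h : TessFace.offset i + TessFace.offset j + TessFace.offset k = (1, 1) := by
    revert i j k
    decide
  obtain ⟨h1, h2⟩ := Prod.ext_iff.1 h
  simp only [Prod.fst_add, Prod.snd_add] at h1 h2
  constructor <;> ext <;> simp [TessFace.corner, TessFace.neighbor] <;> omega

theorem ray_corner_down (m n : ℤ) {i j k : Fin 3} (hij : i ≠ j) (hik : i ≠ k) (hjk : j ≠ k) :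
    Q.ray (TessFace.corner (m, n, false) i) j k =
      Q.edge (TessFace.neighbor (m, n, false) k) j k := by
  rw [ray, edge_eq_iff Q hjk hjk, TessFace.corner_neighbor _ hij.symm hjk hik]
  have h : TessFace.offset i + TessFace.offset j + TessFace.offset k = (1, 1) := by
    revert i j k
    decide
  obtain ⟨h1, h2⟩ := Prod.ext_iff.1 h
  simp only [Prod.fst_add, Prod.snd_add] at h1 h2
  constructor <;> ext <;> simp [TessFace.corner, TessFace.neighbor] <;> omega

theorem ray_ne (v : ℤ × ℤ) {i j i' j' : Fin 3} (hij : i ≠ j) (hij' : i' ≠ j')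
    (h : (i, j) ≠ (i', j')) : Q.ray v i j ≠ Q.ray v i' j' := by
  intro heq
  have h1 := ((Q.edge_eq_iff hij hij').1 heq).2
  have h2 : TessFace.offset j - TessFace.offset i = TessFace.offset j' - TessFace.offset i' := by
    obtain ⟨h3, h4⟩ := Prod.ext_iff.1 h1
    simp only [TessFace.corner, Prod.fst_add, Prod.snd_add] at h3 h4
    ext <;> simp only [Prod.fst_sub, Prod.snd_sub] <;> omega
  clear heq h1
  revert i j i' j'
  decide

/-- Of the six faces around `v`, the upward ones span rays with the same first index and the
downward ones rays with the same second index (`ray_adj_ray_right`). -/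
theorem ray_adj_ray_left (hK : K.IsMoebiusKantor) (v : ℤ × ℤ) {i j k : Fin 3} (hij : i ≠ j)
    (hik : i ≠ k) (hjk : j ≠ k) : K.dartGraph.Adj (Q.ray v i j) (Q.ray v i k) :=
  hK.dartGraph_adj _ (by simpa) (by simpa) (by simpa)

theorem ray_adj_ray_right (hK : K.IsMoebiusKantor) (v : ℤ × ℤ) {i j k : Fin 3} (hij : i ≠ j)
    (hik : i ≠ k) (hjk : j ≠ k) : K.dartGraph.Adj (Q.ray v j i) (Q.ray v k i) := by
  have key : ∀ {i j : Fin 3}, i ≠ j → Q.ray v j i = Q.edge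
      (v.1 - 1 + (TessFace.offset i).1, v.2 - 1 + (TessFace.offset i).2, false) i j := by
    intro i j hij
    rw [ray, edge_eq_iff Q hij.symm hij]
    constructor <;> ext <;> simp [TessFace.corner] <;> ring
  rw [key hij, key hik]
  exact hK.dartGraph_adj _ (by simpa) (by simpa) (by simpa)

theorem isFullPair_ray_symm (hK : K.IsMoebiusKantor) (v : ℤ × ℤ) {j k : Fin 3} (hjk : j ≠ k) :
    K.dartGraph.IsFullPair (Q.ray v j k) (Q.ray v k j) ↔
      K.dartGraph.IsFullPair (Q.ray v k j) (Q.ray v j k) := by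
  obtain ⟨i, hij, hik⟩ : ∃ i, i ≠ j ∧ i ≠ k := by
    revert j k
    decide
  exact hK.isFullPair_symm (Q.ray_adj_ray_left hK v hjk hij.symm hik.symm)
    (Q.ray_adj_ray_right hK v hij hik hjk) (Q.ray_adj_ray_left hK v hik.symm hjk.symm hij)
    (Q.ray_ne v hjk hik.symm (by simp [hjk])) (Q.ray_ne v hij.symm hjk.symm (by simp [hjk]))

/-- The angles labelled `i` at the vertex `v` of the flat have rank 2. -/
def RankTwo (v : ℤ × ℤ) (i : Fin 3) : Prop :=
  K.dartGraph.IsFullPair (Q.ray v (i + 1) (i + 2)) (Q.ray v (i + 2) (i + 1))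

theorem rankTwo_iff (hK : K.IsMoebiusKantor) (v : ℤ × ℤ) {i j k : Fin 3} (hij : i ≠ j)
    (hik : i ≠ k) (hjk : j ≠ k) :
    Q.RankTwo v i ↔ K.dartGraph.IsFullPair (Q.ray v j k) (Q.ray v k j) := by
  rcases Fin3.cases_of_ne hij hik hjk with ⟨rfl, rfl⟩ | ⟨rfl, rfl⟩
  · rfl
  · exact Q.isFullPair_ray_symm hK v hjk.symm

theorem isFullPair_root_iff (hK : K.IsMoebiusKantor) (T : TessFace) (i : Fin 3) :
    K.dartGraph.IsFullPair ((Q.largeTriangle T).rootStart (Q.σ T i))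
      ((Q.largeTriangle T).rootEnd (Q.σ T i)) ↔ Q.RankTwo (T.corner i) i := by
  obtain ⟨j, k, hij, hik, hjk, h1, h2⟩ := Q.root_ends T i
  obtain ⟨m, n, b⟩ := T
  rw [h1, h2]
  cases b
  · rw [← Q.ray_corner_down m n hij hik hjk, ← Q.ray_corner_down m n hik hij hjk.symm,
      Q.rankTwo_iff hK _ hik hij hjk.symm]
  · rw [← Q.ray_corner_up m n hij hik hjk, ← Q.ray_corner_up m n hik hij hjk.symm,
      Q.rankTwo_iff hK _ hij hik hjk]

/-- At every vertex of a flat, exactly one of the three pairs of opposite angles does not have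
rank 2. -/
theorem exists_label (hK : K.IsMoebiusKantor) (v : ℤ × ℤ) :
    ∃ s : Fin 3, ∀ i, Q.RankTwo v i ↔ s ≠ i := by
  -- The six rays in cyclic order; the opposite pairs `(f, c)`, `(b, e)`, `(d, a)` belong to the
  -- labels 0, 1, 2.
  have h := hK.hexagon (a := Q.ray v 0 1) (b := Q.ray v 0 2) (c := Q.ray v 1 2)
    (d := Q.ray v 1 0) (e := Q.ray v 2 0) (f := Q.ray v 2 1)
    (Q.ray_adj_ray_left hK v (by decide) (by decide) (by decide))
    (Q.ray_adj_ray_right hK v (by decide) (by decide) (by decide))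
    (Q.ray_adj_ray_left hK v (by decide) (by decide) (by decide))
    (Q.ray_adj_ray_right hK v (by decide) (by decide) (by decide))
    (Q.ray_adj_ray_left hK v (by decide) (by decide) (by decide))
    (Q.ray_adj_ray_right hK v (by decide) (by decide) (by decide))
    (Q.ray_ne v (by decide) (by decide) (by decide))
    (Q.ray_ne v (by decide) (by decide) (by decide))
    (Q.ray_ne v (by decide) (by decide) (by decide))
  rw [← Q.rankTwo_iff hK v (i := 0) (by decide) (by decide) (by decide),
    ← Q.rankTwo_iff hK v (i := 1) (by decide) (by decide) (by decide),
    ← Q.rankTwo_iff hK v (i := 2) (by decide) (by decide) (by decide)] at h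
  by_cases h0 : Q.RankTwo v 0
  · by_cases h1 : Q.RankTwo v 1
    · refine ⟨2, fun i => ?_⟩
      fin_cases i <;> simp <;> tauto
    · refine ⟨1, fun i => ?_⟩
      fin_cases i <;> simp <;> tauto
  · refine ⟨0, fun i => ?_⟩
    fin_cases i <;> simp <;> tauto

theorem exists_parity_eq (hK : K.IsMoebiusKantor) :
    ∃ s : ℤ × ℤ → Fin 3, ∀ T, K.parity (Q.F T) = parityOfLabels s T := by
  classical
  choose s hs using Q.exists_label hK
  refine ⟨s, fun T => ?_⟩
  -- The sum runs over the corners of the image face; `σ T` brings it back to the corners of `T`.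
  rw [parity_eq_sum hK (Q.largeTriangle T), ← Equiv.sum_comp (Q.σ T), parityOfLabels]
  refine Finset.sum_congr rfl fun i _ => ?_
  rw [if_congr ((Q.isFullPair_root_iff hK T i).trans (hs _ i)) rfl rfl]
  exact ite_not _ _ _

end TessellatedPlane

end TriangleComplex

theorem mainTheorem4 :
    ∃ p : AbstractParityDistribution,
      ∀ K : TriangleComplex.{u}, K.IsMoebiusKantor → ¬ K.Realizes p := by
  obtain ⟨p, hp⟩ := exists_ne_parityOfLabels
  refine ⟨p, fun K hK ⟨P, _, h⟩ => ?_⟩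
  obtain ⟨Q, hQ⟩ := h.exists_tessellatedPlane
  obtain ⟨s, hs⟩ := Q.exists_parity_eq hK
  exact hp s (funext fun T => (hQ T).trans (hs T))
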